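/- Let $q\in\mathbb C\setminus\{0\}$ be generic, i.e. $q^k\neq 1$ for all $k\ge 1$; put $\omega=q-q^{-1}$ and $k_q=(q^k-q^{-k})/(q-q^{-1})$. Let $V=\mathbb C^N$ and let $R\in\mathrm{End}(V^{\otimes 2})$ be a Hecke symmetry, i.e. $R_1R_2R_1=R_2R_1R_2$ on $V^{\otimes 3}$ and $(q-R)(q^{-1}+R)=0$, where $R_i$ denotes $R$ acting in the tensor factors $i,i+1$. Assume that * $R$ is skew-invertible: there is $\Psi\in\mathrm{End}(V^{\otimes 2})$ with $\mathrm{Tr}_{(2)}(R_{12}\Psi_{23})=P_{13}=\mathrm{Tr}_{(2)}(\Psi_{12}R_{23})$, $P$ being the flip; put $C=\mathrm{Tr}_{(2)}\Psi$; * $R$ is even of bi-rank $(m|0)$: the Hilbert–Poincaré series of the $R$-skew-symmetric algebra $T(V)/\langle \mathrm{Im}(q^{-1}+R)\rangle$ is a polynomial of degree $m$. Let $\mathcal L(R)$ be the reflection equation algebra, the unital associative $\mathbb C$-algebra generated by the entries of the $N\times N$ matrix $L=\|l_i^j\|$ subject to $R(L\otimes I)R(L\otimes I)=(L\otimes I)R(L\otimes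 I)R$. Put $L_{\overline 1}=L\otimes I\otimes\cdots\otimes I$, $L_{\overline{k+1}}=R_kL_{\overline k}R_k^{-1}$, and $\langle Z\rangle_{1\dots k}=\mathrm{Tr}_{(1\dots k)}(C_1\cdots C_kZ)$, where $C_i$ is $C$ acting in the $i$-th factor. Let $$p_k=\langle R_{k-1}\cdots R_1L_{\overline 1}\cdots L_{\overline k}\rangle_{1\dots k},\qquad t_k=\langle R_{k-1}^{-1}\cdots R_1^{-1}L_{\overline 1}\cdots L_{\overline k}\rangle_{1\dots k},\qquad a_k=\langle A^{(k)}L_{\overline 1}\cdots L_{\overline k}\rangle_{1\dots k}\qquad(k\ge1)$$ be the power sums of the first and of the second kind and the elementary symmetric polynomials, where $A^{(k)}$ is the $q$-antisymmetrizer, i.e. the image in $\mathrm{End}(V^{\otimes k})$ of the primitive idempotent of the Hecke algebra attached to the partition $(1^k)$: $A^{(1)}=1$, $A^{(k+1)}=\frac1{(k+1)_q}A^{(k)}\bigl(q^k-k_qR_k\bigr)A^{(k)}$. Put $P(x)=\sum_{k\ge1}p_kx^k$ and $T(x)=\sum_{k\ge1}t_kx^k$. Let $E$ be a unital associative $\mathbb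 C$-algebra with a homomorphism $\mathcal L(R)\to E$, and let $\mu_1,\dots,\mu_m$ be spectral values of $L$ in $E$: central elements of $E$ such that $$q^ka_k=\sum_{1\le i_1<\dots<i_k\le m}\mu_{i_1}\cdots\mu_{i_k}\quad\text{in }E,\qquad 1\le k\le m$$ (for instance, $E=\mathcal L(R)[\mu_1,\dots,\mu_m]$, the algebra obtained from $\mathcal L(R)$ by adjoining central elements $\mu_i$ subject to these relations). Then the following identities of formal power series in $x$ hold over $E$ (the coefficients of $P$ and $T$ being replaced by their images in $E$): $$1+\omega P(x)=\prod_{i=1}^m\frac{1-q^{-2}\mu_ix}{1-\mu_ix},\qquad 1-\omega T(x)=\prod_{i=1}^m\frac{1-\mu_ix}{1-q^{-2}\mu_ix}.$$ -/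

import Mathlib

open scoped Kronecker

namespace ReflectionEq

noncomputable section

/-! ### Matrices acting on tensor powers

A matrix on `V^{⊗n}`, where `V = ℂ^N`, has rows and columns indexed by `Fin n → Fin N`;
tensor factors are numbered `0, …, n - 1`. -/

/-- The matrix on `V^{⊗n}` that acts as `M` in the `i`-th factor and as the identity elsewhere. -/
def oneSite {S : Type*} [Zero S] {N n : ℕ} (i : Fin n) (M : Matrix (Fin N) (Fin N) S) :
    Matrix (Fin n → Fin N) (Fin n → Fin N) S :=
  Matrix.of fun v w => if ∀ k, k ≠ i → v k = w k then M (v i) (w i) else 0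

/-- The matrix on `V^{⊗(n+1)}` that acts as `M` in the neighbouring factors `i`, `i + 1`
and as the identity elsewhere. -/
def twoSite {S : Type*} [Zero S] {N n : ℕ} (i : Fin n)
    (M : Matrix (Fin N × Fin N) (Fin N × Fin N) S) :
    Matrix (Fin (n + 1) → Fin N) (Fin (n + 1) → Fin N) S :=
  Matrix.of fun v w =>
    if ∀ k, k ≠ i.castSucc → k ≠ i.succ → v k = w k then
      M (v i.castSucc, v i.succ) (w i.castSucc, w i.succ) else 0

/-- The tensor power `C^{⊗n} = C_1 C_2 ⋯ C_n` of an `N × N` matrix `C`. -/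
def tensorPow {N : ℕ} (C : Matrix (Fin N) (Fin N) ℂ) (n : ℕ) :
    Matrix (Fin n → Fin N) (Fin n → Fin N) ℂ :=
  Matrix.of fun v w => ∏ k, C (v k) (w k)

/-- The `q`-number `k_q = (q^k - q^{-k}) / (q - q^{-1})`. -/
def qNum (q : ℂ) (k : ℕ) : ℂ := (q ^ k - (q⁻¹) ^ k) / (q - q⁻¹)

/-! ### Hecke symmetries -/

/-- A Hecke symmetry: a solution of the braid relation `R₁₂ R₂₃ R₁₂ = R₂₃ R₁₂ R₂₃` on `V^{⊗3}`
satisfying the Hecke condition `(q - R)(q⁻¹ + R) = 0`. -/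
structure IsHeckeSymmetry {N : ℕ} (q : ℂ) (R : Matrix (Fin N × Fin N) (Fin N × Fin N) ℂ) :
    Prop where
  braid : twoSite (0 : Fin 2) R * twoSite (1 : Fin 2) R * twoSite (0 : Fin 2) R =
    twoSite (1 : Fin 2) R * twoSite (0 : Fin 2) R * twoSite (1 : Fin 2) R
  hecke : (q • (1 : Matrix (Fin N × Fin N) (Fin N × Fin N) ℂ) - R) *
    (q⁻¹ • (1 : Matrix (Fin N × Fin N) (Fin N × Fin N) ℂ) + R) = 0

/-- `Ψ` is the skew-inverse of `R`: `Tr_(2) (R₁₂ Ψ₂₃) = P₁₃ = Tr_(2) (Ψ₁₂ R₂₃)`, where `P` is the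
flip and the trace is over the middle factor of `V^{⊗3}`; both equalities are written for the
matrix element with row `(i, k)` and column `(i', k')` in the factors 1 and 3. -/
structure IsSkewInverse {N : ℕ} (R Ψ : Matrix (Fin N × Fin N) (Fin N × Fin N) ℂ) : Prop where
  left : ∀ i k i' k' : Fin N, ∑ a, ∑ b, R (i, a) (i', b) * Ψ (b, k) (a, k') =
    if i = k' ∧ k = i' then 1 else 0
  right : ∀ i k i' k' : Fin N, ∑ a, ∑ b, Ψ (i, a) (i', b) * R (b, k) (a, k') =
    if i = k' ∧ k = i' then 1 else 0

/-- The matrix `C = Tr_(2) Ψ` defining the `R`-trace. -/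
def traceMatrix {N : ℕ} (Ψ : Matrix (Fin N × Fin N) (Fin N × Fin N) ℂ) :
    Matrix (Fin N) (Fin N) ℂ :=
  Matrix.of fun i j => ∑ a, Ψ (i, a) (j, a)

/-! ### The `R`-skew-symmetric algebra and the bi-rank -/

/-- The generators of the ideal `⟨Im (q⁻¹ + R)⟩` of the tensor algebra of `V` (the free algebra on
the basis vectors of `V`), set equal to `0`. -/
inductive SkewRel {N : ℕ} (q : ℂ) (R : Matrix (Fin N × Fin N) (Fin N × Fin N) ℂ) :
    FreeAlgebra ℂ (Fin N) → FreeAlgebra ℂ (Fin N) → Prop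
  | of (j : Fin N × Fin N) : SkewRel q R
      (∑ i : Fin N × Fin N,
        (q⁻¹ • (1 : Matrix (Fin N × Fin N) (Fin N × Fin N) ℂ) + R) i j •
          (FreeAlgebra.ι ℂ i.1 * FreeAlgebra.ι ℂ i.2)) 0

/-- The `R`-skew-symmetric algebra `T(V) / ⟨Im (q⁻¹ + R)⟩`. -/
abbrev SkewAlgebra {N : ℕ} (q : ℂ) (R : Matrix (Fin N × Fin N) (Fin N × Fin N) ℂ) : Type :=
  RingQuot (SkewRel q R)

/-- The homogeneous component of degree `k` of the `R`-skew-symmetric algebra: the span of the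
products of `k` generators. -/
def skewComponent {N : ℕ} (q : ℂ) (R : Matrix (Fin N × Fin N) (Fin N × Fin N) ℂ) (k : ℕ) :
    Submodule ℂ (SkewAlgebra q R) :=
  (Submodule.span ℂ (Set.range fun i : Fin N =>
    RingQuot.mkAlgHom ℂ (SkewRel q R) (FreeAlgebra.ι ℂ i))) ^ k

/-- The Hilbert–Poincaré series of the `R`-skew-symmetric algebra. -/
def skewHilbertSeries {N : ℕ} (q : ℂ) (R : Matrix (Fin N × Fin N) (Fin N × Fin N) ℂ) :
    PowerSeries ℕ :=
  PowerSeries.mk fun k => Module.finrank ℂ (skewComponent q R k)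

/-- `R` is even of bi-rank `(m|0)`: the Hilbert–Poincaré series of the `R`-skew-symmetric algebra
is a polynomial of degree `m`. -/
def HasBiRank {N : ℕ} (q : ℂ) (R : Matrix (Fin N × Fin N) (Fin N × Fin N) ℂ) (m : ℕ) : Prop :=
  ∃ H : Polynomial ℕ, H.natDegree = m ∧ (H : PowerSeries ℕ) = skewHilbertSeries q R

/-! ### The reflection equation algebra -/

/-- The generic matrix `L ⊗ I` on `V^{⊗2}` over the free algebra on the symbols `l_{ij}`. -/
def freeL (N : ℕ) :
    Matrix (Fin N × Fin N) (Fin N × Fin N) (FreeAlgebra ℂ (Fin N × Fin N)) :=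
  (Matrix.of fun i j : Fin N => FreeAlgebra.ι ℂ (i, j)) ⊗ₖ
    (1 : Matrix (Fin N) (Fin N) (FreeAlgebra ℂ (Fin N × Fin N)))

/-- The defining relations `R (L ⊗ I) R (L ⊗ I) = (L ⊗ I) R (L ⊗ I) R`, entry by entry. -/
inductive RERel {N : ℕ} (R : Matrix (Fin N × Fin N) (Fin N × Fin N) ℂ) :
    FreeAlgebra ℂ (Fin N × Fin N) → FreeAlgebra ℂ (Fin N × Fin N) → Prop
  | of (i j : Fin N × Fin N) : RERel R
      ((R.map (algebraMap ℂ (FreeAlgebra ℂ (Fin N × Fin N))) * freeL N *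
        R.map (algebraMap ℂ (FreeAlgebra ℂ (Fin N × Fin N))) * freeL N) i j)
      ((freeL N * R.map (algebraMap ℂ (FreeAlgebra ℂ (Fin N × Fin N))) * freeL N *
        R.map (algebraMap ℂ (FreeAlgebra ℂ (Fin N × Fin N)))) i j)

/-- The reflection equation algebra `𝓛(R)`. -/
abbrev REAlgebra {N : ℕ} (R : Matrix (Fin N × Fin N) (Fin N × Fin N) ℂ) : Type :=
  RingQuot (RERel R)

/-- The generating matrix `L` of `𝓛(R)`. -/
def genL {N : ℕ} (R : Matrix (Fin N × Fin N) (Fin N × Fin N) ℂ) :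
    Matrix (Fin N) (Fin N) (REAlgebra R) :=
  Matrix.of fun i j => RingQuot.mkAlgHom ℂ (RERel R) (FreeAlgebra.ι ℂ (i, j))

/-- A complex matrix regarded as a matrix over `𝓛(R)`. -/
def scal {N : ℕ} (R : Matrix (Fin N × Fin N) (Fin N × Fin N) ℂ) {ι : Type*}
    (M : Matrix ι ι ℂ) : Matrix ι ι (REAlgebra R) :=
  M.map (algebraMap ℂ (REAlgebra R))

/-- The copies of `L` on `V^{⊗(n+1)}`: `L` in the first factor, and then
`L̄_{k+1} = R_k L̄_k R_k⁻¹`. -/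
def barL {N : ℕ} (R : Matrix (Fin N × Fin N) (Fin N × Fin N) ℂ) (n : ℕ) :
    Fin (n + 1) → Matrix (Fin (n + 1) → Fin N) (Fin (n + 1) → Fin N) (REAlgebra R) :=
  Fin.induction (motive := fun _ =>
      Matrix (Fin (n + 1) → Fin N) (Fin (n + 1) → Fin N) (REAlgebra R))
    (oneSite 0 (genL R))
    (fun i X => scal R (twoSite i R) * X * scal R (twoSite i R⁻¹))

/-- The ordered product `L̄_1 L̄_2 ⋯ L̄_{n+1}` on `V^{⊗(n+1)}`. -/
def barLProd {N : ℕ} (R : Matrix (Fin N × Fin N) (Fin N × Fin N) ℂ) (n : ℕ) :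
    Matrix (Fin (n + 1) → Fin N) (Fin (n + 1) → Fin N) (REAlgebra R) :=
  (List.ofFn (barL R n)).prod

/-- The element `⟨Z L̄_1 ⋯ L̄_{n+1}⟩_{1…n+1} = Tr (C_1 ⋯ C_{n+1} Z L̄_1 ⋯ L̄_{n+1})` of `𝓛(R)`
attached to a complex matrix `Z` on `V^{⊗(n+1)}` (the image of an element of the Hecke algebra). -/
def charElt {N : ℕ} (R Ψ : Matrix (Fin N × Fin N) (Fin N × Fin N) ℂ) {n : ℕ}
    (Z : Matrix (Fin (n + 1) → Fin N) (Fin (n + 1) → Fin N) ℂ) : REAlgebra R :=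
  Matrix.trace (scal R (tensorPow (traceMatrix Ψ) (n + 1)) * (scal R Z * barLProd R n))

/-- The power sums of the first kind, `p_k = ⟨R_{k-1} ⋯ R_1 L̄_1 ⋯ L̄_k⟩` for `k ≥ 1`
(the value at `0` is set to `0`, so that it does not contribute to the generating function). -/
def powerSum {N : ℕ} (R Ψ : Matrix (Fin N × Fin N) (Fin N × Fin N) ℂ) : ℕ → REAlgebra R
  | 0 => 0
  | n + 1 => charElt R Ψ (List.ofFn fun i : Fin n => twoSite i R).reverse.prod

/-- The power sums of the second kind, `t_k = ⟨R_{k-1}⁻¹ ⋯ R_1⁻¹ L̄_1 ⋯ L̄_k⟩` for `k ≥ 1`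
(the value at `0` is set to `0`, so that it does not contribute to the generating function). -/
def powerSum' {N : ℕ} (R Ψ : Matrix (Fin N × Fin N) (Fin N × Fin N) ℂ) : ℕ → REAlgebra R
  | 0 => 0
  | n + 1 => charElt R Ψ (List.ofFn fun i : Fin n => twoSite i R⁻¹).reverse.prod

/-- The `q`-antisymmetrizers `A^(1), …, A^(n+1)` on `V^{⊗(n+1)}`, i.e. the images of the primitive
idempotents of the Hecke algebras attached to the one-column partitions `(1^k)`, on which every
`R_i` acts as `-q⁻¹`: `A^(1) = 1` and
`A^(k+1) = ((k+1)_q)⁻¹ A^(k) (q^k - k_q R_k) A^(k)`. The index `i` stands for `A^(i+1)`. -/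
def antisymm {N : ℕ} (q : ℂ) (R : Matrix (Fin N × Fin N) (Fin N × Fin N) ℂ) (n : ℕ) :
    Fin (n + 1) → Matrix (Fin (n + 1) → Fin N) (Fin (n + 1) → Fin N) ℂ :=
  Fin.induction (motive := fun _ => Matrix (Fin (n + 1) → Fin N) (Fin (n + 1) → Fin N) ℂ)
    1
    (fun i A => (qNum q (i.val + 2))⁻¹ •
      (A * (q ^ (i.val + 1) • (1 : Matrix (Fin (n + 1) → Fin N) (Fin (n + 1) → Fin N) ℂ) -
        qNum q (i.val + 1) • twoSite i R) * A))

/-- The elementary symmetric polynomials `a_k = ⟨A^(k) L̄_1 ⋯ L̄_k⟩`, with `a_0 = 1`. -/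
def elemSymm {N : ℕ} (q : ℂ) (R Ψ : Matrix (Fin N × Fin N) (Fin N × Fin N) ℂ) :
    ℕ → REAlgebra R
  | 0 => 1
  | n + 1 => charElt R Ψ (antisymm q R n (Fin.last n))

/-- The generating function `P(x) = ∑_{k ≥ 1} p_k x^k`. -/
def genP {N : ℕ} (R Ψ : Matrix (Fin N × Fin N) (Fin N × Fin N) ℂ) :
    PowerSeries (REAlgebra R) :=
  PowerSeries.mk (powerSum R Ψ)

/-- The generating function `T(x) = ∑_{k ≥ 1} t_k x^k`. -/
def genT {N : ℕ} (R Ψ : Matrix (Fin N × Fin N) (Fin N × Fin N) ℂ) :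
    PowerSeries (REAlgebra R) :=
  PowerSeries.mk (powerSum' R Ψ)

/-- Central elements `μ_1, …, μ_m` of an algebra `E` over `𝓛(R)` are spectral values of `L` if
`q^k a_k(L) = ∑_{i_1 < ⋯ < i_k} μ_{i_1} ⋯ μ_{i_k}` in `E` for `1 ≤ k ≤ m`. -/
def IsSpectrum {N m : ℕ} (q : ℂ) (R Ψ : Matrix (Fin N × Fin N) (Fin N × Fin N) ℂ)
    {E : Type*} [Ring E] [Algebra ℂ E] (φ : REAlgebra R →ₐ[ℂ] E)
    (μ : Fin m → Subalgebra.center ℂ E) : Prop :=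
  ∀ k : ℕ, 1 ≤ k → k ≤ m →
    φ (q ^ k • elemSymm q R Ψ k) =
      ((∑ s ∈ Finset.powersetCard k (Finset.univ : Finset (Fin m)), ∏ i ∈ s, μ i :
        Subalgebra.center ℂ E) : E)

/-- The formal power series `1 - a x`. -/
def lin {K : Type*} [CommRing K] (a : K) : PowerSeries K :=
  1 - PowerSeries.C a * PowerSeries.X

/-- The formal power series `(1 - a x)⁻¹`. -/
def linInv {K : Type*} [CommRing K] (a : K) : PowerSeries K :=
  PowerSeries.invOfUnit (lin a) 1

theorem lin_mul_linInv {K : Type*} [CommRing K] (a : K) : lin a * linInv a = 1 :=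
  PowerSeries.mul_invOfUnit _ _ (by simp [lin])

end

end ReflectionEq

/-! The proof rests on Newton identities between the a_k and either family of power sums. Put Y(i,n)
= ⟨A^(i+1) R_{i+n} ⋯ R_{i+1} L̄_1 ⋯ L̄_{i+n+1}⟩, so that Y(i,0) = a_{i+1} and Y(0,n) = p_{n+1}.
Inserting the recursive definition of A^(i+2) into Y(i+1,n) gives (`IsTower.newton_step`) (i+2)_q
Y(i+1,n) = q^{i+1} a_{i+1} p_{n+1} - (i+1)_q Y(i,n+1), and unrolling yields k_q a_k = ∑_{i<k}
(-1)^{k-1-i} q^i a_i p_{k-i}. With R_i replaced by its inverse the same argument works, because R_i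
= R_i⁻¹ + ω and q^k - ω k_q = q^{-k}: the t_k satisfy the identities with q^i replaced by q^{-i}.

The recursion needs two properties of the bracket. It is cyclic in the R_i: skew-invertibility and
the braid relation force C⊗C to commute with R, and the reflection equation makes every R_i commute
with L̄_1 ⋯ L̄_k. It is also multiplicative on operators in disjoint blocks of factors
(`IsTower.brk_mul`), because Tr_(2)(C_2 R X_1 R⁻¹) = Tr(C X) lets a block be shifted back to the
first factors. These facts are derived from the axioms `IsTower`, and the axioms are verified for
operators on functions of infinite words, where all tensor powers act in one algebra.

For k > m the antisymmetrizer A^(k) vanishes: it kills the images of all q⁻¹ + R_i, hence factors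
through the degree k component of the skew-symmetric algebra, which is zero. So q^k a_k is the k-th
elementary symmetric function of the μ_i for every k, and ∑ a_k (-uqx)^k = ∏ (1 - uμ_i x). As ω k_q
= q^k - q^{-k}, the Newton identities become ∏ (1 - uμ_i x) · ω G(x) = ∏ (1 - q⁻²μ_i x) - ∏ (1 - μ_i
x), with G = P for u = 1 and G = T for u = q⁻². Dividing by the product on the left gives both
formulas. -/

namespace ReflectionEq

set_option linter.unusedSectionVars false

open Finset

/-! ### Commuting systems of matrix units -/

/-- A family of systems of matrix units, indexed by the sites `ι`, that commute with each other. -/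
structure MatrixUnits {ι n A : Type*} [Fintype n] [DecidableEq n] [Ring A]
    (e : ι → n → n → A) : Prop where
  mul : ∀ i a b c d, e i a b * e i c d = if b = c then e i a d else 0
  sum : ∀ i, ∑ a, e i a a = 1
  comm : ∀ i j, i ≠ j → ∀ a b c d, Commute (e i a b) (e j c d)

section Units

variable {ι n A : Type*} [Fintype n] [DecidableEq n] [Ring A] [Algebra ℂ A]

/-- The matrix `M` acting at the site `i`. -/
def site (e : ι → n → n → A) (i : ι) (M : Matrix n n ℂ) : A := ∑ a, ∑ b, M a b • e i a b

/-- The matrix `M` acting at the sites `i` and `j`. -/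
def pair (e : ι → n → n → A) (i j : ι) (M : Matrix (n × n) (n × n) ℂ) : A :=
  ∑ p, ∑ r, M p r • (e i p.1 r.1 * e j p.2 r.2)

/-- The partial trace over the site `i`. -/
def ptr (e : ι → n → n → A) (i : ι) : A →ₗ[ℂ] A :=
  ∑ a, ∑ c, LinearMap.mulLeftRight ℂ (e i c a, e i a c)

/-- The partial trace over the site `i` weighted by `C`. -/
def wtr (e : ι → n → n → A) (C : Matrix n n ℂ) (i : ι) : A →ₗ[ℂ] A :=
  ptr e i ∘ₗ LinearMap.mulLeft ℂ (site e i C)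

variable {e : ι → n → n → A}

lemma ptr_apply (i : ι) (x : A) : ptr e i x = ∑ a, ∑ c, e i c a * x * e i a c := by
  simp [ptr, LinearMap.sum_apply]

lemma wtr_apply (C : Matrix n n ℂ) (i : ι) (x : A) : wtr e C i x = ptr e i (site e i C * x) := rfl

lemma commute_site {y : A} {i : ι} (h : ∀ a b, Commute y (e i a b)) (M : Matrix n n ℂ) :
    Commute y (site e i M) :=
  Commute.sum_right _ _ _ fun _ _ => Commute.sum_right _ _ _ fun _ _ => (h _ _).smul_right _

lemma commute_pair {y : A} {i j : ι} (hi : ∀ a b, Commute y (e i a b))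
    (hj : ∀ a b, Commute y (e j a b)) (M : Matrix (n × n) (n × n) ℂ) :
    Commute y (pair e i j M) :=
  Commute.sum_right _ _ _ fun _ _ => Commute.sum_right _ _ _ fun _ _ =>
    ((hi _ _).mul_right (hj _ _)).smul_right _

lemma ptr_mul_left {y : A} {i : ι} (h : ∀ a b, Commute y (e i a b)) (x : A) :
    ptr e i (y * x) = y * ptr e i x := by
  simp only [ptr_apply, mul_sum]
  refine sum_congr rfl fun a _ => sum_congr rfl fun c _ => ?_
  rw [← mul_assoc (e i c a), ← (h c a).eq]; simp only [mul_assoc]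

lemma ptr_mul_right {y : A} {i : ι} (h : ∀ a b, Commute y (e i a b)) (x : A) :
    ptr e i (x * y) = ptr e i x * y := by
  simp only [ptr_apply, sum_mul]
  refine sum_congr rfl fun a _ => sum_congr rfl fun c _ => ?_
  simp only [mul_assoc, (h a c).eq]

lemma wtr_mul_left {y : A} {i : ι} (h : ∀ a b, Commute y (e i a b)) (C : Matrix n n ℂ) (x : A) :
    wtr e C i (y * x) = y * wtr e C i x := by
  rw [wtr_apply, wtr_apply, ← ptr_mul_left h, ← mul_assoc, ← (commute_site h C).eq, mul_assoc]

lemma wtr_mul_right {y : A} {i : ι} (h : ∀ a b, Commute y (e i a b)) (C : Matrix n n ℂ) (x : A) :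
    wtr e C i (x * y) = wtr e C i x * y := by
  rw [wtr_apply, wtr_apply, ← ptr_mul_right h, mul_assoc]

lemma commute_ptr {y x : A} {i : ι} (h : ∀ a b, Commute y (e i a b)) (hx : Commute y x) :
    Commute y (ptr e i x) := by
  rw [ptr_apply]
  exact Commute.sum_right _ _ _ fun _ _ => Commute.sum_right _ _ _ fun _ _ =>
    ((h _ _).mul_right hx).mul_right (h _ _)

lemma commute_wtr {y x : A} {i : ι} (h : ∀ a b, Commute y (e i a b)) (hx : Commute y x)
    (C : Matrix n n ℂ) : Commute y (wtr e C i x) :=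
  commute_ptr h ((commute_site h C).mul_right hx)

namespace MatrixUnits

variable (he : MatrixUnits e)
include he

/-- The value of `ptr` is the traced operator times the identity at the site `i`. This is why a
trace over the last site lands one step lower in the filtration. -/
lemma unit_commute_ptr (i : ι) (a b : n) (x : A) : Commute (e i a b) (ptr e i x) := by
  simp only [Commute, SemiconjBy, ptr_apply, mul_sum, sum_mul]
  have h1 : ∀ p c, e i a b * (e i c p * x * e i p c) =
      if b = c then e i a p * x * e i p b else 0 := by
    intro p c
    rw [← mul_assoc, ← mul_assoc, he.mul]
    split_ifs with h
    · rw [h]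
    · simp
  have h2 : ∀ p c, e i c p * x * e i p c * e i a b =
      if c = a then e i a p * x * e i p b else 0 := by
    intro p c
    rw [mul_assoc, he.mul]
    split_ifs with h
    · rw [h]
    · simp
  simp [h1, h2]

lemma unit_commute_wtr (i : ι) (a b : n) (C : Matrix n n ℂ) (x : A) :
    Commute (e i a b) (wtr e C i x) := he.unit_commute_ptr _ _ _ _

lemma ptr_unit_mul (i : ι) (a b : n) (x : A) : ptr e i (e i a b * x) = ptr e i (x * e i a b) := by
  have h1 : ∀ p c, e i c p * (e i a b * x) * e i p c =
      if p = a then e i c b * x * e i a c else 0 := by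
    intro p c
    rw [← mul_assoc, he.mul]
    split_ifs with h
    · rw [h]
    · simp
  have h2 : ∀ p c, e i c p * (x * e i a b) * e i p c =
      if b = p then e i c b * x * e i a c else 0 := by
    intro p c
    rw [mul_assoc, mul_assoc, he.mul]
    split_ifs with h
    · rw [h, mul_assoc]
    · simp
  simp only [ptr_apply, h1, h2]
  rw [sum_comm, sum_comm (f := fun p c => if b = p then e i c b * x * e i a c else 0)]
  simp

lemma ptr_unit (i : ι) (a b : n) : ptr e i (e i a b) = if a = b then 1 else 0 := by
  have h : ∀ p c, e i c p * e i a b * e i p c = if p = a then (if a = b then e i c c else 0)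
      else 0 := by
    intro p c
    rw [he.mul]
    by_cases h : p = a
    · subst h; simp [he.mul, eq_comm]
    · simp [h]
  simp only [ptr_apply, h]
  rw [sum_comm]
  by_cases hab : a = b <;> simp [hab, he.sum]

lemma pair_mul {i j : ι} (hij : i ≠ j) (M M' : Matrix (n × n) (n × n) ℂ) :
    pair e i j M * pair e i j M' = pair e i j (M * M') := by
  have key : ∀ p r s t : n × n, (e i p.1 r.1 * e j p.2 r.2) * (e i s.1 t.1 * e j s.2 t.2) =
      if r = s then e i p.1 t.1 * e j p.2 t.2 else 0 := by
    intro p r s t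
    have hc := (he.comm j i hij.symm p.2 r.2 s.1 t.1).eq
    calc _ = e i p.1 r.1 * (e j p.2 r.2 * e i s.1 t.1) * e j s.2 t.2 := by simp only [mul_assoc]
      _ = (e i p.1 r.1 * e i s.1 t.1) * (e j p.2 r.2 * e j s.2 t.2) := by
        rw [hc]; simp only [mul_assoc]
      _ = _ := by
        rw [he.mul, he.mul]
        by_cases h1 : r.1 = s.1 <;> by_cases h2 : r.2 = s.2 <;> simp [h1, h2, Prod.ext_iff]
  simp only [pair, sum_mul]
  simp only [mul_sum, smul_mul_smul_comm, key, Matrix.mul_apply, sum_smul, smul_ite, smul_zero]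
  refine sum_congr rfl fun p _ => ?_
  simp only [sum_comm (f := fun s t => if _ = s then _ else _)]
  simp
  rw [sum_comm]

lemma pair_one {i j : ι} : pair e i j 1 = 1 := by
  simp only [pair, Matrix.one_apply, ite_smul, zero_smul, one_smul]
  simp only [sum_ite_eq, mem_univ, if_true]
  rw [Fintype.sum_prod_type]
  simp [← mul_sum, he.sum]

lemma site_one {i : ι} : site e i 1 = 1 := by
  simp [site, Matrix.one_apply, he.sum]

lemma unit_eq_pair (i j : ι) (a b : n) :
    e i a b = pair e i j (.of fun p r => if p.1 = a ∧ r.1 = b ∧ p.2 = r.2 then 1 else 0) := by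
  simp only [pair, Matrix.of_apply, ite_smul, zero_smul, one_smul, Fintype.sum_prod_type]
  have : ∀ p1 p2 r1 r2 : n, (if p1 = a ∧ r1 = b ∧ p2 = r2 then e i p1 r1 * e j p2 r2 else 0) =
      if p1 = a then (if r1 = b then (if p2 = r2 then e i a b * e j p2 r2 else 0) else 0)
        else 0 := by
    intro p1 p2 r1 r2
    split_ifs <;> simp_all
  simp only [this]
  simp [sum_ite_eq, ← mul_sum, he.sum]

lemma site_mul_site {i j : ι} (M M' : Matrix n n ℂ) :
    site e i M * site e j M' = pair e i j (.of fun p r => M p.1 r.1 * M' p.2 r.2) := by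
  simp only [pair, site, Matrix.of_apply, Fintype.sum_prod_type, sum_mul]
  simp only [mul_sum, smul_mul_smul_comm]
  refine sum_congr rfl fun a _ => ?_
  rw [sum_comm]

/-- Each matrix unit is moved cyclically inside the trace over its own site and passes freely
through the other trace. -/
lemma ptr_ptr_pair {i j : ι} (hij : i ≠ j) (M : Matrix (n × n) (n × n) ℂ) (x : A) :
    ptr e i (ptr e j (pair e i j M * x)) = ptr e i (ptr e j (x * pair e i j M)) := by
  simp only [pair, sum_mul, mul_sum, map_sum, smul_mul_assoc, mul_smul_comm, map_smul]
  refine sum_congr rfl fun p _ => sum_congr rfl fun r _ => ?_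
  congr 1
  have h := fun a b c d => he.comm i j hij a b c d
  rw [mul_assoc, ptr_mul_left (fun a b => h _ _ _ _), he.ptr_unit_mul, he.ptr_unit_mul,
    ← ptr_mul_right (fun a b => h _ _ _ _), mul_assoc, (h _ _ _ _).eq]

lemma wtr_pair {i j : ι} (hij : i ≠ j) (C : Matrix n n ℂ) (M : Matrix (n × n) (n × n) ℂ) :
    wtr e C j (pair e i j M) = site e i (.of fun a b => ∑ x, ∑ y, C y x * M (a, x) (b, y)) := by
  have h : ∀ (p r : n × n), wtr e C j (e i p.1 r.1 * e j p.2 r.2) =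
      C r.2 p.2 • e i p.1 r.1 := by
    intro p r
    rw [wtr_mul_left (fun a b => he.comm i j hij _ _ _ _), wtr_apply]
    simp only [site, sum_mul, smul_mul_assoc, he.mul, map_sum, map_smul, smul_ite, smul_zero,
      apply_ite (ptr e j), map_zero, he.ptr_unit]
    simp
  simp only [pair, map_sum, map_smul, h, site, Matrix.of_apply, sum_smul, smul_smul]
  simp only [Fintype.sum_prod_type]
  refine sum_congr rfl fun a _ => ?_
  rw [sum_comm]
  refine sum_congr rfl fun b _ => sum_congr rfl fun x _ => sum_congr rfl fun y _ => ?_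
  rw [mul_comm]

/-- If `M e_{ab} M'` has weighted partial trace `C_{ba}` for all matrix units of the first factor,
then conjugation moves the weighted trace from the site `i` to the site `j`. -/
lemma wtr_conj {i j : ι} (hij : i ≠ j) (C : Matrix n n ℂ) (M M' : Matrix (n × n) (n × n) ℂ)
    (h : ∀ a b s t, ∑ x, ∑ y, C y x * ∑ p, M (s, x) (a, p) * M' (b, p) (t, y) =
      if s = t then C b a else 0)
    {x : A} (hx : ∀ a b, Commute x (e j a b)) :
    wtr e C j (pair e i j M * x * pair e i j M') = wtr e C i x := by
  -- The case where `x` is a matrix unit; here the claim is the hypothesis `h`, entry by entry.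
  have hunit : ∀ a b, wtr e C j (pair e i j M * e i a b * pair e i j M') = C b a • 1 := by
    intro a b
    rw [he.unit_eq_pair i j, he.pair_mul hij, he.pair_mul hij, he.wtr_pair hij, ← he.site_one,
      site, site, smul_sum]
    refine sum_congr rfl fun s _ => ?_
    rw [smul_sum]
    refine sum_congr rfl fun t _ => ?_
    rw [smul_smul]
    congr 1
    have : C b a * (1 : Matrix n n ℂ) s t = if s = t then C b a else 0 := by
      simp [Matrix.one_apply]
    rw [this, ← h a b s t]
    refine sum_congr rfl fun x _ => sum_congr rfl fun y _ => ?_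
    congr 1
    have aux : ∀ r2 r1 p1 p2 : n, (M (s, x) (r1, r2) *
        if r1 = a ∧ p1 = b ∧ r2 = p2 then (1 : ℂ) else 0) =
        if p1 = b then (if r1 = a then (if r2 = p2 then M (s, x) (a, p2) else 0) else 0)
          else 0 := by
      intro r2 r1 p1 p2
      split_ifs <;> simp_all
    simp [Matrix.mul_apply, Matrix.of_apply, Fintype.sum_prod_type, aux]
  -- The coefficient of `e i a b` commutes with all units at `i`, and with those at `j` because `x`
  -- does. It can therefore be pulled out of the trace, leaving the case of a matrix unit.
  have hdec : x = ∑ a, ∑ b, (∑ c, e i c a * x * e i b c) * e i a b := by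
    have : ∀ a b, (∑ c, e i c a * x * e i b c) * e i a b = e i a a * x * e i b b := by
      intro a b
      rw [sum_mul]
      simp [mul_assoc, he.mul]
    simp only [this, ← mul_sum, he.sum, mul_one, ← sum_mul, one_mul]
  have hc : ∀ a b, (∀ c d, Commute (∑ c, e i c a * x * e i b c) (e i c d)) ∧
      ∀ c d, Commute (∑ c, e i c a * x * e i b c) (e j c d) := by
    intro a b
    refine ⟨fun s t => ?_, fun s t => Commute.sum_left _ _ _ fun c _ =>
      (((he.comm i j hij _ _ _ _).mul_left (hx _ _)).mul_left (he.comm i j hij _ _ _ _))⟩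
    simp only [Commute, SemiconjBy, mul_sum, sum_mul]
    have h1 : ∀ c, e i c a * x * e i b c * e i s t =
        if c = s then e i s a * x * e i b t else 0 := by
      intro c
      rw [mul_assoc, he.mul]
      split_ifs with h
      · rw [h]
      · simp
    have h2 : ∀ c, e i s t * (e i c a * x * e i b c) =
        if t = c then e i s a * x * e i b t else 0 := by
      intro c
      rw [← mul_assoc, ← mul_assoc, he.mul]
      split_ifs with h
      · rw [h]
      · simp
    simp [h1, h2]
  have step : ∀ a b, wtr e C j (pair e i j M * ((∑ c, e i c a * x * e i b c) * e i a b) *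
      pair e i j M') = C b a • ∑ c, e i c a * x * e i b c := by
    intro a b
    rw [← mul_assoc, ← (commute_pair (hc a b).1 (hc a b).2 M).eq, mul_assoc, mul_assoc,
      wtr_mul_left (hc a b).2, ← mul_assoc, hunit, mul_smul_comm, mul_one]
  conv_lhs => rw [hdec]
  rw [mul_sum, sum_mul, map_sum]
  simp only [mul_sum univ _ (pair e i j M), sum_mul univ _ (pair e i j M'), map_sum, step]
  rw [wtr_apply, ptr_apply]
  have h3 : ∀ p c, e i c p * (site e i C * x) * e i p c =
      ∑ t, C p t • (e i c t * x * e i p c) := by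
    intro p c
    have : e i c p * site e i C = ∑ t, C p t • e i c t := by
      simp only [site, mul_sum, mul_smul_comm, he.mul]
      simp
    rw [← mul_assoc, this, sum_mul, sum_mul]
    simp
  simp only [h3, smul_sum]
  rw [sum_comm]
  exact sum_congr rfl fun p _ => sum_comm

end MatrixUnits

end Units

/-! ### Identities for a skew-invertible Hecke symmetry -/

lemma sum_twoSite_mul {S : Type*} [Semiring S] {N n : ℕ} (i : Fin n)
    (M : Matrix (Fin N × Fin N) (Fin N × Fin N) S) (v : Fin (n + 1) → Fin N)
    (g : (Fin (n + 1) → Fin N) → S) :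
    ∑ w, twoSite i M v w * g w = ∑ p : Fin N × Fin N, M (v i.castSucc, v i.succ) p *
      g (Function.update (Function.update v i.castSucc p.1) i.succ p.2) := by
  have hne : i.castSucc ≠ i.succ := (Fin.castSucc_lt_succ).ne
  symm
  apply Fintype.sum_of_injective
    (fun p : Fin N × Fin N => Function.update (Function.update v i.castSucc p.1) i.succ p.2)
  · intro p r h
    have h1 := congrFun h i.castSucc
    have h2 := congrFun h i.succ
    simp only [Function.update_self, Function.update_of_ne hne] at h1 h2
    exact Prod.ext h1 h2
  · intro w hw
    have : ¬ ∀ k, k ≠ i.castSucc → k ≠ i.succ → v k = w k := by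
      intro h
      refine hw ⟨(w i.castSucc, w i.succ), ?_⟩
      funext k
      by_cases h2 : k = i.succ
      · subst h2; simp
      by_cases h1 : k = i.castSucc
      · subst h1; simp [hne]
      · simp [h1, h2, h k h1 h2]
    simp [twoSite, this]
  · intro p
    have : ∀ k, k ≠ i.castSucc → k ≠ i.succ →
        v k = Function.update (Function.update v i.castSucc p.1) i.succ p.2 k := by
      intro k h1 h2
      simp [h1, h2]
    simp only [twoSite, Matrix.of_apply, if_pos this]
    simp [hne]

lemma twoSite_mul {S : Type*} [Semiring S] {N n : ℕ} (i : Fin n)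
    (M M' : Matrix (Fin N × Fin N) (Fin N × Fin N) S) :
    twoSite i M * twoSite i M' = twoSite i (M * M') := by
  have hne : i.castSucc ≠ i.succ := (Fin.castSucc_lt_succ).ne
  ext v w
  rw [Matrix.mul_apply, sum_twoSite_mul]
  have h : ∀ p : Fin N × Fin N,
      twoSite i M' (Function.update (Function.update v i.castSucc p.1) i.succ p.2) w =
      if ∀ k, k ≠ i.castSucc → k ≠ i.succ → v k = w k then
        M' p (w i.castSucc, w i.succ) else 0 := by
    intro p
    simp only [twoSite, Matrix.of_apply]
    have : (∀ k, k ≠ i.castSucc → k ≠ i.succ →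
        Function.update (Function.update v i.castSucc p.1) i.succ p.2 k = w k) ↔
        ∀ k, k ≠ i.castSucc → k ≠ i.succ → v k = w k :=
      forall_congr' fun k => forall_congr' fun h1 => forall_congr' fun h2 => by simp [h1, h2]
    simp [this, hne]
  simp only [h]
  simp only [twoSite, Matrix.of_apply, Matrix.mul_apply]
  split_ifs <;> simp

lemma twoSite_one {S : Type*} [Semiring S] {N n : ℕ} (i : Fin n) :
    twoSite i (1 : Matrix (Fin N × Fin N) (Fin N × Fin N) S) = 1 := by
  ext v w
  simp only [twoSite, Matrix.of_apply, Matrix.one_apply, Prod.mk.injEq]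
  by_cases h : v = w
  · simp [h]
  · rw [if_neg h]
    split_ifs with h1 h2
    · refine absurd (funext fun k => ?_) h
      by_cases e1 : k = i.castSucc
      · rw [e1, h2.1]
      by_cases e2 : k = i.succ
      · rw [e2, h2.2]
      exact h1 k e1 e2
    · rfl
    · rfl

section Three

variable {N : ℕ} (M M' M'' : Matrix (Fin N × Fin N) (Fin N × Fin N) ℂ)

/-- This and the next lemma put braid-type relations on three factors into coordinates, ready to be
contracted with Ψ in the first factor and with C in the third. -/
lemma twoSite_one_zero_one_apply (b i x a j y : Fin N) :
    (twoSite (1 : Fin 2) M * (twoSite (0 : Fin 2) M' * twoSite (1 : Fin 2) M''))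
      ![b, i, x] ![a, j, y] =
    ∑ c, ∑ p, ∑ d, M (i, x) (c, p) * (M' (b, c) (a, d) * M'' (d, p) (j, y)) := by
  have u1 : ∀ c p : Fin N, Function.update (Function.update ![b, i, x] (1 : Fin 3) c) 2 p =
      ![b, c, p] := by
    intro c p; funext k; fin_cases k <;> simp
  have u2 : ∀ c p s d : Fin N, Function.update (Function.update ![b, c, p] (0 : Fin 3) s) 1 d =
      ![s, d, p] := by
    intro c p s d; funext k; fin_cases k <;> simp
  have t : ∀ s d p : Fin N, twoSite (1 : Fin 2) M'' ![s, d, p] ![a, j, y] =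
      if s = a then M'' (d, p) (j, y) else 0 := by
    intro s d p
    simp [twoSite, Fin.forall_fin_succ]
    rfl
  rw [Matrix.mul_apply, sum_twoSite_mul, Fintype.sum_prod_type]
  refine sum_congr rfl fun c _ => sum_congr rfl fun p _ => ?_
  rw [← mul_sum]
  congr 1
  simp only [Fin.isValue, Fin.castSucc_one, Fin.succ_one_eq_two, u1]
  rw [Matrix.mul_apply, sum_twoSite_mul, Fintype.sum_prod_type]
  simp [u2, t]

lemma twoSite_zero_one_zero_apply (b i x a j y : Fin N) :
    (twoSite (0 : Fin 2) M * (twoSite (1 : Fin 2) M' * twoSite (0 : Fin 2) M''))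
      ![b, i, x] ![a, j, y] =
    ∑ c, ∑ f, ∑ g, M (b, i) (c, f) * (M' (f, x) (g, y) * M'' (c, g) (a, j)) := by
  have u1 : ∀ c p : Fin N, Function.update (Function.update ![b, i, x] (0 : Fin 3) c) 1 p =
      ![c, p, x] := by
    intro c p; funext k; fin_cases k <;> simp
  have u2 : ∀ c p s d : Fin N, Function.update (Function.update ![c, p, x] (1 : Fin 3) s) 2 d =
      ![c, s, d] := by
    intro c p s d; funext k; fin_cases k <;> simp
  have t : ∀ s d p : Fin N, twoSite (0 : Fin 2) M'' ![s, d, p] ![a, j, y] =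
      if p = y then M'' (s, d) (a, j) else 0 := by
    intro s d p
    simp [twoSite, Fin.forall_fin_succ]
    rfl
  rw [Matrix.mul_apply, sum_twoSite_mul, Fintype.sum_prod_type]
  refine sum_congr rfl fun c _ => sum_congr rfl fun p _ => ?_
  rw [← mul_sum]
  congr 1
  simp only [Fin.isValue, Fin.castSucc_zero, Fin.succ_zero_eq_one, u1]
  rw [Matrix.mul_apply, sum_twoSite_mul, Fintype.sum_prod_type]
  simp [u2, t]

end Three

lemma sum_two_three {α M : Type*} [Fintype α] [AddCommMonoid M] (F : α → α → α → α → α → M) :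
    ∑ u, ∑ w, ∑ c, ∑ p, ∑ d, F u w c p d = ∑ c, ∑ p, ∑ d, ∑ u, ∑ w, F u w c p d := by
  have h := sum_comm (s := (univ : Finset (α × α))) (t := (univ : Finset (α × α × α)))
    (f := fun x y => F x.1 x.2 y.1 y.2.1 y.2.2)
  simpa only [Fintype.sum_prod_type] using h

lemma sum_two_two {α M : Type*} [Fintype α] [AddCommMonoid M] (F : α → α → α → α → M) :
    ∑ u, ∑ w, ∑ c, ∑ p, F u w c p = ∑ c, ∑ p, ∑ u, ∑ w, F u w c p := by
  have h := sum_comm (s := (univ : Finset (α × α))) (t := (univ : Finset (α × α)))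
    (f := fun x y => F x.1 x.2 y.1 y.2)
  simpa only [Fintype.sum_prod_type] using h

section Skew

variable {N : ℕ} {R Ri Ψ : Matrix (Fin N × Fin N) (Fin N × Fin N) ℂ}

/-- This is Tr_(2)(C_2 R_12) = 1: take the trace of the left skew-inverse condition over its third
factor, where Ψ becomes C and the flip becomes the identity. -/
lemma sum_traceMatrix_mul (hΨ : IsSkewInverse R Ψ) (f g : Fin N) :
    ∑ x, ∑ y, traceMatrix Ψ y x * R (f, x) (g, y) = if f = g then 1 else 0 := by
  have h : ∀ k, ∑ a, ∑ b, R (f, a) (g, b) * Ψ (b, k) (a, k) = if f = k ∧ k = g then 1 else 0 :=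
    fun k => hΨ.left f k g k
  have h2 : ∑ k, (if f = k ∧ k = g then (1 : ℂ) else 0) = if f = g then 1 else 0 := by
    simp [ite_and]
  rw [← h2, ← sum_congr rfl fun k _ => h k]
  conv_rhs => rw [sum_comm]
  refine sum_congr rfl fun x _ => ?_
  conv_rhs => rw [sum_comm]
  refine sum_congr rfl fun y _ => ?_
  simp [traceMatrix, mul_sum, mul_comm]

/-- If `A₁₂ R₀₁ B₁₂ = B₀₁ R₁₂ A₀₁` with `B A = 1`, then
`Tr₂ (C₂ A₁₂ X₁ B₁₂) = Tr (C X)`. -/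
lemma sum_traceMatrix_conj (hΨ : IsSkewInverse R Ψ)
    {A B : Matrix (Fin N × Fin N) (Fin N × Fin N) ℂ} (hBA : B * A = 1)
    (h : twoSite (1 : Fin 2) A * (twoSite (0 : Fin 2) R * twoSite (1 : Fin 2) B) =
      twoSite (0 : Fin 2) B * (twoSite (1 : Fin 2) R * twoSite (0 : Fin 2) A))
    (a b s t : Fin N) :
    ∑ x, ∑ y, traceMatrix Ψ y x * ∑ p, A (s, x) (a, p) * B (b, p) (t, y) =
      if s = t then traceMatrix Ψ b a else 0 := by
  -- The relation `h` is contracted with Ψ in the first factor and with C in the third. On the left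
  -- Ψ meets R and produces a flip, which leaves the sum of the claim. On the right C meets R and
  -- disappears, then `B * A = 1` leaves Ψ traced over its second factor, that is C.
  have key : ∑ x, ∑ y, ∑ u, ∑ w, traceMatrix Ψ y x * (Ψ (b, w) (a, u) *
      (∑ c, ∑ p, ∑ d, A (s, x) (c, p) * (R (u, c) (w, d) * B (d, p) (t, y)))) =
      ∑ x, ∑ y, ∑ u, ∑ w, traceMatrix Ψ y x * (Ψ (b, w) (a, u) *
      (∑ c, ∑ f, ∑ g, B (u, s) (c, f) * (R (f, x) (g, y) * A (c, g) (w, t)))) := by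
    simp only [← twoSite_one_zero_one_apply, ← twoSite_zero_one_zero_apply, h]
  have hL : ∀ x y, ∑ u, ∑ w, traceMatrix Ψ y x * (Ψ (b, w) (a, u) *
      (∑ c, ∑ p, ∑ d, A (s, x) (c, p) * (R (u, c) (w, d) * B (d, p) (t, y)))) =
      traceMatrix Ψ y x * ∑ p, A (s, x) (a, p) * B (b, p) (t, y) := by
    intro x y
    have hr : ∀ c d, ∑ u, ∑ w, Ψ (b, w) (a, u) * R (u, c) (w, d) =
        if b = d ∧ c = a then 1 else 0 := by
      intro c d
      rw [sum_comm]
      exact hΨ.right b c a d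
    simp only [← mul_sum]
    congr 1
    calc _ = ∑ c, ∑ p, ∑ d, A (s, x) (c, p) * ((∑ u, ∑ w, Ψ (b, w) (a, u) * R (u, c) (w, d)) *
          B (d, p) (t, y)) := by
          simp only [mul_sum, sum_mul]
          rw [sum_two_three]
          refine sum_congr rfl fun _ _ => sum_congr rfl fun _ _ => sum_congr rfl fun _ _ =>
            sum_congr rfl fun _ _ => sum_congr rfl fun _ _ => ?_
          ring
      _ = _ := by
        simp only [hr]
        simp [ite_and]
  have hR : ∀ u w, ∑ x, ∑ y, traceMatrix Ψ y x * (Ψ (b, w) (a, u) *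
      (∑ c, ∑ f, ∑ g, B (u, s) (c, f) * (R (f, x) (g, y) * A (c, g) (w, t)))) =
      Ψ (b, w) (a, u) * if (u, s) = (w, t) then 1 else 0 := by
    intro u w
    calc _ = Ψ (b, w) (a, u) * ∑ c, ∑ f, ∑ g, B (u, s) (c, f) *
          ((∑ x, ∑ y, traceMatrix Ψ y x * R (f, x) (g, y)) * A (c, g) (w, t)) := by
          simp only [mul_sum, sum_mul]
          rw [sum_two_three]
          refine sum_congr rfl fun _ _ => sum_congr rfl fun _ _ => sum_congr rfl fun _ _ =>
            sum_congr rfl fun _ _ => sum_congr rfl fun _ _ => ?_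
          ring
      _ = _ := by
        rw [← Matrix.one_apply, ← hBA, Matrix.mul_apply, Fintype.sum_prod_type]
        simp [sum_traceMatrix_mul hΨ]
  simp only [hL] at key
  rw [key, sum_two_two]
  simp only [hR]
  by_cases hst : s = t <;> simp [hst, traceMatrix]

/-- The tensor square of the trace matrix commutes with `R⁻¹`. -/
lemma traceMatrix_kronecker_mul_comm (hΨ : IsSkewInverse R Ψ)
    (h1 : ∀ a b s t : Fin N, ∑ x, ∑ y, traceMatrix Ψ y x * ∑ p, R (s, x) (a, p) * Ri (b, p) (t, y) =
      if s = t then traceMatrix Ψ b a else 0)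
    (h2 : ∀ a b s t : Fin N, ∑ x, ∑ y, traceMatrix Ψ y x * ∑ p, Ri (s, x) (a, p) * R (b, p) (t, y) =
      if s = t then traceMatrix Ψ b a else 0) :
    (traceMatrix Ψ ⊗ₖ traceMatrix Ψ) * Ri = Ri * (traceMatrix Ψ ⊗ₖ traceMatrix Ψ) := by
  have hr : ∀ z z' c d, ∑ u, ∑ w, Ψ (z, w) (z', u) * R (u, c) (w, d) =
      if z = d ∧ c = z' then 1 else 0 := by
    intro z z' c d
    rw [sum_comm]
    exact hΨ.right z c z' d
  -- Contracting `h1` with Ψ removes R and expresses `Ri` times C in the second factor through C and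
  -- Ψ; `e2` does the same with C on the other side. Both sides of the claim then become the same
  -- contraction of C, Ψ and C.
  have e1 : ∀ b u j u', ∑ y, Ri (b, u) (j, y) * traceMatrix Ψ y u' =
      ∑ a, traceMatrix Ψ b a * Ψ (u, a) (u', j) := by
    intro b u j u'
    have : ∑ i, ∑ a, Ψ (u, a) (u', i) * (∑ x, ∑ y, ∑ p, traceMatrix Ψ y x *
        (R (i, x) (a, p) * Ri (b, p) (j, y))) =
        ∑ i, ∑ a, Ψ (u, a) (u', i) * if i = j then traceMatrix Ψ b a else 0 := by
      simp only [← mul_sum, h1]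
    have l : ∑ i, ∑ a, Ψ (u, a) (u', i) * (∑ x, ∑ y, ∑ p, traceMatrix Ψ y x *
        (R (i, x) (a, p) * Ri (b, p) (j, y))) = ∑ x, ∑ y, ∑ p,
        traceMatrix Ψ y x * ((∑ i, ∑ a, Ψ (u, a) (u', i) * R (i, x) (a, p)) *
        Ri (b, p) (j, y)) := by
      simp only [mul_sum, sum_mul]
      rw [sum_two_three]
      refine sum_congr rfl fun _ _ => sum_congr rfl fun _ _ => sum_congr rfl fun _ _ =>
            sum_congr rfl fun _ _ => sum_congr rfl fun _ _ => ?_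
      ring
    rw [l] at this
    simp only [hr] at this
    simpa [ite_and, mul_comm] using this
  have e2 : ∀ u i a u', ∑ x, traceMatrix Ψ u x * Ri (i, x) (a, u') =
      ∑ b, Ψ (u, i) (u', b) * traceMatrix Ψ b a := by
    intro u i a u'
    have : ∑ b, ∑ j, Ψ (u, j) (u', b) * (∑ x, ∑ y, ∑ p, traceMatrix Ψ y x *
        (Ri (i, x) (a, p) * R (b, p) (j, y))) =
        ∑ b, ∑ j, Ψ (u, j) (u', b) * if i = j then traceMatrix Ψ b a else 0 := by
      simp only [← mul_sum, h2]
    have l : ∑ b, ∑ j, Ψ (u, j) (u', b) * (∑ x, ∑ y, ∑ p, traceMatrix Ψ y x *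
        (Ri (i, x) (a, p) * R (b, p) (j, y))) = ∑ x, ∑ y, ∑ p,
        traceMatrix Ψ y x * ((∑ b, ∑ j, Ψ (u, j) (u', b) * R (b, p) (j, y)) *
        Ri (i, x) (a, p)) := by
      simp only [mul_sum, sum_mul]
      rw [sum_two_three]
      refine sum_congr rfl fun _ _ => sum_congr rfl fun _ _ => sum_congr rfl fun _ _ =>
            sum_congr rfl fun _ _ => sum_congr rfl fun _ _ => ?_
      ring
    rw [l] at this
    simp only [hr] at this
    simpa [ite_and] using this
  ext ⟨b, u⟩ ⟨a, u'⟩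
  simp only [Matrix.mul_apply, Fintype.sum_prod_type, Matrix.kroneckerMap_apply]
  calc _ = ∑ i, traceMatrix Ψ b i * ∑ x, traceMatrix Ψ u x * Ri (i, x) (a, u') := by
        simp only [mul_sum, mul_assoc]
    _ = ∑ c, (∑ y, Ri (b, u) (c, y) * traceMatrix Ψ y u') * traceMatrix Ψ c a := by
        simp only [e1, e2, mul_sum, sum_mul]
        rw [sum_comm]
        simp only [mul_assoc]
    _ = _ := by
        simp only [sum_mul]
        refine sum_congr rfl fun _ _ => sum_congr rfl fun _ _ => ?_
        ring

end Skew

section Hecke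

variable {N : ℕ} {q : ℂ} {R : Matrix (Fin N × Fin N) (Fin N × Fin N) ℂ}

lemma IsHeckeSymmetry.mul_self (hq0 : q ≠ 0) (hR : IsHeckeSymmetry q R) :
    R * R = (q - q⁻¹) • R + 1 := by
  have h := hR.hecke
  simp only [sub_mul, mul_add, smul_mul_assoc, one_mul, mul_smul_comm, mul_one, smul_sub, smul_smul,
    inv_mul_cancel₀ hq0, one_smul] at h
  rw [sub_smul, ← sub_eq_zero, ← neg_eq_zero, ← h]
  abel

lemma IsHeckeSymmetry.mul_sub (hq0 : q ≠ 0) (hR : IsHeckeSymmetry q R) :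
    R * (R - (q - q⁻¹) • 1) = 1 := by
  rw [Matrix.mul_sub, hR.mul_self hq0]
  simp

lemma IsHeckeSymmetry.inv_eq (hq0 : q ≠ 0) (hR : IsHeckeSymmetry q R) :
    R⁻¹ = R - (q - q⁻¹) • 1 :=
  Matrix.inv_eq_right_inv (hR.mul_sub hq0)

lemma IsHeckeSymmetry.mul_inv (hq0 : q ≠ 0) (hR : IsHeckeSymmetry q R) : R * R⁻¹ = 1 := by
  rw [hR.inv_eq hq0, hR.mul_sub hq0]

lemma IsHeckeSymmetry.inv_mul (hq0 : q ≠ 0) (hR : IsHeckeSymmetry q R) : R⁻¹ * R = 1 :=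
  mul_eq_one_comm.mp (hR.mul_inv hq0)

variable {Ψ : Matrix (Fin N × Fin N) (Fin N × Fin N) ℂ}

/-- The required relation is the braid relation written as R₂₃ R₁₂ R₂₃⁻¹ = R₁₂⁻¹ R₂₃ R₁₂. The result
lets the R-trace migrate from one factor to the next. -/
lemma IsHeckeSymmetry.sum_conj (hq0 : q ≠ 0) (hR : IsHeckeSymmetry q R)
    (hΨ : IsSkewInverse R Ψ) (a b s t : Fin N) :
    ∑ x, ∑ y, traceMatrix Ψ y x * ∑ p, R (s, x) (a, p) * R⁻¹ (b, p) (t, y) =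
      if s = t then traceMatrix Ψ b a else 0 := by
  refine sum_traceMatrix_conj hΨ (hR.inv_mul hq0) ?_ a b s t
  have h0 : twoSite (0 : Fin 2) R⁻¹ * twoSite (0 : Fin 2) R = 1 := by
    rw [twoSite_mul, hR.inv_mul hq0, twoSite_one]
  have h1 : twoSite (1 : Fin 2) R * twoSite (1 : Fin 2) R⁻¹ = 1 := by
    rw [twoSite_mul, hR.mul_inv hq0, twoSite_one]
  have hb := hR.braid
  generalize twoSite (0 : Fin 2) R = T0 at *
  generalize twoSite (1 : Fin 2) R = T1 at *
  generalize twoSite (0 : Fin 2) R⁻¹ = S0 at *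
  generalize twoSite (1 : Fin 2) R⁻¹ = S1 at *
  calc T1 * (T0 * S1) = (S0 * T0) * (T1 * T0 * S1) := by rw [h0]; simp [mul_assoc]
    _ = S0 * (T0 * T1 * T0) * S1 := by simp only [mul_assoc]
    _ = S0 * (T1 * T0) * (T1 * S1) := by rw [hb]; simp only [mul_assoc]
    _ = _ := by rw [h1, mul_one]

lemma IsHeckeSymmetry.sum_inv_conj (hq0 : q ≠ 0) (hR : IsHeckeSymmetry q R)
    (hΨ : IsSkewInverse R Ψ) (a b s t : Fin N) :
    ∑ x, ∑ y, traceMatrix Ψ y x * ∑ p, R⁻¹ (s, x) (a, p) * R (b, p) (t, y) =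
      if s = t then traceMatrix Ψ b a else 0 := by
  refine sum_traceMatrix_conj hΨ (hR.mul_inv hq0) ?_ a b s t
  have h0 : twoSite (0 : Fin 2) R * twoSite (0 : Fin 2) R⁻¹ = 1 := by
    rw [twoSite_mul, hR.mul_inv hq0, twoSite_one]
  have h1 : twoSite (1 : Fin 2) R⁻¹ * twoSite (1 : Fin 2) R = 1 := by
    rw [twoSite_mul, hR.inv_mul hq0, twoSite_one]
  have hb := hR.braid
  generalize twoSite (0 : Fin 2) R = T0 at *
  generalize twoSite (1 : Fin 2) R = T1 at *
  generalize twoSite (0 : Fin 2) R⁻¹ = S0 at *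
  generalize twoSite (1 : Fin 2) R⁻¹ = S1 at *
  calc S1 * (T0 * T1) = S1 * (T0 * T1 * T0) * S0 := by simp only [mul_assoc, h0, mul_one]
    _ = (S1 * T1) * (T0 * T1 * S0) := by rw [hb]; simp only [mul_assoc]
    _ = _ := by rw [h1]; simp [mul_assoc]

/-- Since R⁻¹ differs from R by a scalar, commutation with R⁻¹ suffices. This is the source of the
cyclicity of the R-trace. -/
lemma IsHeckeSymmetry.kronecker_mul_comm (hq0 : q ≠ 0) (hR : IsHeckeSymmetry q R)
    (hΨ : IsSkewInverse R Ψ) :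
    (traceMatrix Ψ ⊗ₖ traceMatrix Ψ) * R = R * (traceMatrix Ψ ⊗ₖ traceMatrix Ψ) := by
  have h := traceMatrix_kronecker_mul_comm hΨ (hR.sum_conj hq0 hΨ) (hR.sum_inv_conj hq0 hΨ)
  rw [hR.inv_eq hq0, Matrix.mul_sub, Matrix.sub_mul] at h
  simpa using h

end Hecke

/-! ### Towers of algebras with partial traces and a reflection matrix -/

section TowerDefs

variable {A : Type*} [Ring A] [Algebra ℂ A]

/-- The abstract properties of the algebras of operators on the first `k` tensor factors, of the
`R`-traces over the factors, of the braid generators and of the matrix `L`. -/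
structure IsTower (F : ℕ → Subalgebra ℂ A) (E : ℕ → A →ₗ[ℂ] A) (r : ℕ → Aˣ) (l : A) : Prop where
  mono : Monotone F
  E_mem : ∀ {k x}, x ∈ F (k + 1) → E k x ∈ F k
  E_left : ∀ {k y}, y ∈ F k → ∀ x, E k (y * x) = y * E k x
  E_right : ∀ {k y}, y ∈ F k → ∀ x, E k (x * y) = E k x * y
  r_mem : ∀ k, (r k : A) ∈ F (k + 2)
  inv_mem : ∀ k, (↑(r k)⁻¹ : A) ∈ F (k + 2)
  r_comm : ∀ {k x}, x ∈ F k → Commute (r k : A) x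
  E_conj : ∀ {k x}, x ∈ F (k + 1) → E (k + 1) (r k * x * ↑(r k)⁻¹) = E k x
  E_cyc : ∀ k x, E k (E (k + 1) (r k * x)) = E k (E (k + 1) (x * r k))
  braid : ∀ k, r k * r (k + 1) * r k = r (k + 1) * r k * r (k + 1)
  l_mem : l ∈ F 1
  refl : r 0 * l * r 0 * l = l * r 0 * l * r 0

/-- The matrices `L̄_k`. -/
def copyL (r : ℕ → Aˣ) (l : A) : ℕ → A
  | 0 => l
  | k + 1 => r k * copyL r l k * ↑(r k)⁻¹

/-- The product `L̄_s ⋯ L̄_{s+j-1}`. -/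
def prodL (r : ℕ → Aˣ) (l : A) (s : ℕ) : ℕ → A
  | 0 => 1
  | j + 1 => prodL r l s j * copyL r l (s + j)

/-- The product `t_{s+n-1} ⋯ t_s`. -/
def descProd (t : ℕ → Aˣ) (s : ℕ) : ℕ → Aˣ
  | 0 => 1
  | n + 1 => t (s + n) * descProd t s n

/-- The product `t_s ⋯ t_{s+n-1}`. -/
def ascProd (t : ℕ → Aˣ) (s : ℕ) : ℕ → Aˣ
  | 0 => 1
  | n + 1 => ascProd t s n * t (s + n)

/-- The iterated trace over the factors `s, …, s + j - 1`. -/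
noncomputable def iterE (E : ℕ → A →ₗ[ℂ] A) (s : ℕ) : ℕ → A →ₗ[ℂ] A
  | 0 => LinearMap.id
  | j + 1 => iterE E s j ∘ₗ E (s + j)

/-- The functional `Z ↦ ⟨Z L̄_1 ⋯ L̄_k⟩`. -/
noncomputable def brk (E : ℕ → A →ₗ[ℂ] A) (r : ℕ → Aˣ) (l : A) (k : ℕ) (z : A) : A :=
  iterE E 0 k (z * prodL r l 0 k)

/-- The `q`-antisymmetrizers; the index `i` stands for `A^(i+1)`. -/
noncomputable def asym (q : ℂ) (r : ℕ → Aˣ) : ℕ → A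
  | 0 => 1
  | i + 1 => (qNum q (i + 2))⁻¹ • (asym q r i *
      (q ^ (i + 1) • (1 : A) - qNum q (i + 1) • (r i : A)) * asym q r i)

lemma descProd_succ' (t : ℕ → Aˣ) (s n : ℕ) :
    descProd t s (n + 1) = descProd t (s + 1) n * t s := by
  induction n with
  | zero => simp [descProd]
  | succ n ih =>
    rw [descProd, ih, descProd, mul_assoc]
    congr 2
    ring

lemma iterE_add (E : ℕ → A →ₗ[ℂ] A) (i j : ℕ) (x : A) :
    iterE E 0 (i + j) x = iterE E 0 i (iterE E i j x) := by
  induction j generalizing x with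
  | zero => rfl
  | succ j ih => simp [← add_assoc, iterE, ih]

lemma prodL_add (r : ℕ → Aˣ) (l : A) (i j : ℕ) :
    prodL r l 0 (i + j) = prodL r l 0 i * prodL r l i j := by
  induction j with
  | zero => simp [prodL]
  | succ j ih => simp [← add_assoc, prodL, ih, mul_assoc]

end TowerDefs

/-! ### q-numbers at generic q. -/

section QNum

variable {q : ℂ}

lemma sub_inv_ne_zero (hq0 : q ≠ 0) (hq : ∀ k : ℕ, 1 ≤ k → q ^ k ≠ 1) : q - q⁻¹ ≠ 0 := by
  intro h
  refine hq 2 (by norm_num) ?_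
  rw [sub_eq_zero] at h
  rw [pow_two]
  nth_rewrite 2 [h]
  exact mul_inv_cancel₀ hq0

lemma qNum_ne_zero (hq0 : q ≠ 0) (hq : ∀ k : ℕ, 1 ≤ k → q ^ k ≠ 1) {k : ℕ} (hk : 1 ≤ k) :
    qNum q k ≠ 0 := by
  refine div_ne_zero (fun h => ?_) (sub_inv_ne_zero hq0 hq)
  refine hq (k + k) (by omega) ?_
  rw [sub_eq_zero] at h
  rw [pow_add]
  nth_rewrite 2 [h]
  rw [← mul_pow, mul_inv_cancel₀ hq0, one_pow]

lemma mul_qNum (h : q - q⁻¹ ≠ 0) (k : ℕ) : (q - q⁻¹) * qNum q k = q ^ k - q⁻¹ ^ k :=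
  mul_div_cancel₀ _ h

lemma qNum_one (h : q - q⁻¹ ≠ 0) : qNum q 1 = 1 := by
  simp [qNum, div_self h]

lemma qNum_succ (hq0 : q ≠ 0) (h : q - q⁻¹ ≠ 0) (k : ℕ) :
    qNum q (k + 1) = q ^ k + q⁻¹ * qNum q k := by
  apply mul_left_cancel₀ h
  rw [mul_add, mul_left_comm, mul_qNum h, mul_qNum h]
  linear_combination (-q ^ k) * mul_inv_cancel₀ hq0 + q ^ k * mul_inv_cancel₀ hq0

end QNum

/-! ### Braid generators and copies of L in a tower. -/

namespace IsTower

variable {A : Type*} [Ring A] [Algebra ℂ A] {F : ℕ → Subalgebra ℂ A} {E : ℕ → A →ₗ[ℂ] A}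
  {r : ℕ → Aˣ} {l : A} (h : IsTower F E r l)
include h

lemma copyL_mem (k : ℕ) : copyL r l k ∈ F (k + 1) := by
  induction k with
  | zero => exact h.l_mem
  | succ k ih =>
    exact mul_mem (mul_mem (h.r_mem k) (h.mono (Nat.le_succ _) ih)) (h.inv_mem k)

lemma zpow_mem (k : ℕ) (z : ℤ) : (↑(r k ^ z) : A) ∈ F (k + 2) := by
  obtain ⟨n, rfl | rfl⟩ := z.eq_nat_or_neg
  · simpa using pow_mem (h.r_mem k) n
  · simpa using pow_mem (h.inv_mem k) n

lemma commute_r {i j : ℕ} (hij : i + 2 ≤ j) : Commute (r j) (r i) := by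
  have := h.r_comm (h.mono hij (h.r_mem i))
  exact Units.ext this

lemma zpow_comm {k : ℕ} {x : A} (hx : x ∈ F k) (z : ℤ) : Commute (↑(r k ^ z) : A) x :=
  ((h.r_comm hx).symm.units_zpow_right z).symm

lemma semiconj_copyL (k : ℕ) : SemiconjBy (r k : A) (copyL r l k) (copyL r l (k + 1)) := by
  simp [SemiconjBy, copyL, mul_assoc]

lemma commute_copyL_of_lt {s j : ℕ} (hs : j < s) : Commute (r s : A) (copyL r l j) :=
  h.r_comm (h.mono hs (h.copyL_mem j))

/-- For j = s + 2 the copy is the conjugate of the s-th one by u = r_{s+1} r_s. The braid relation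
gives r_s u = u r_{s+1}, and r_{s+1} commutes with the s-th copy. -/
lemma commute_copyL_of_gt {s j : ℕ} (hs : s + 2 ≤ j) : Commute (r s : A) (copyL r l j) := by
  induction j, hs using Nat.le_induction with
  | base =>
    have e : copyL r l (s + 2) =
        ↑(r (s + 1) * r s) * copyL r l s * ↑(r (s + 1) * r s)⁻¹ := by
      simp [copyL, mul_assoc]
    have hb : r s * (r (s + 1) * r s) = (r (s + 1) * r s) * r (s + 1) := by
      rw [← mul_assoc, h.braid]
    have hc := h.commute_copyL_of_lt (Nat.lt_succ_self s)
    rw [e]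
    generalize copyL r l s = x at *
    generalize hu : r (s + 1) * r s = u at *
    have h1 : SemiconjBy (u : A) (r (s + 1)) (r s) := by
      rw [SemiconjBy, ← Units.val_mul, ← hb, Units.val_mul]
    have h4 : (r s : A) * u = u * r (s + 1) := h1.eq.symm
    have h5 : u⁻¹.val * (r s : A) = r (s + 1) * u⁻¹.val := by
      rw [Units.inv_mul_eq_iff_eq_mul, ← mul_assoc, ← h4, mul_assoc, Units.mul_inv, mul_one]
    calc (r s : A) * (u * x * ↑u⁻¹) = ((r s : A) * u) * x * ↑u⁻¹ := by simp only [mul_assoc]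
      _ = u * (r (s + 1) * x) * ↑u⁻¹ := by rw [h4]; simp only [mul_assoc]
      _ = u * x * (r (s + 1) * ↑u⁻¹) := by rw [hc.eq]; simp only [mul_assoc]
      _ = _ := by rw [← h5]; simp only [mul_assoc]
  | succ j hj ih =>
    have := (h.commute_r hj).symm
    have h1 : Commute (r s : A) (r j) := congrArg Units.val this.eq
    exact (h1.mul_right ih).mul_right h1.units_inv_right

/-- For s = 0 this is the reflection equation. Conjugation by r_s r_{s+1} carries r_s and the copies
s, s + 1 to r_{s+1} and the copies s + 1, s + 2, which gives the induction. -/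
lemma commute_copyL_mul (s : ℕ) : Commute (r s : A) (copyL r l s * copyL r l (s + 1)) := by
  induction s with
  | zero =>
    have e : copyL r l 0 * copyL r l (0 + 1) = l * r 0 * l * ↑(r 0)⁻¹ := by
      simp [copyL, mul_assoc]
    rw [e]
    have h2 := h.refl
    calc (r 0 : A) * (l * r 0 * l * ↑(r 0)⁻¹) = (r 0 * l * r 0 * l) * ↑(r 0)⁻¹ := by
          simp only [mul_assoc]
      _ = _ := by rw [h2]; simp [mul_assoc]
  | succ s ih =>
    have u : SemiconjBy (↑(r s * r (s + 1)) : A) (r s) (r (s + 1)) := by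
      have := h.braid s
      rw [SemiconjBy, ← Units.val_mul, this, mul_assoc, Units.val_mul]
    have u1 : SemiconjBy (↑(r s * r (s + 1)) : A) (copyL r l s) (copyL r l (s + 1)) := by
      rw [Units.val_mul]
      exact (h.semiconj_copyL s).mul_left (h.commute_copyL_of_lt (Nat.lt_succ_self s))
    have u2 : SemiconjBy (↑(r s * r (s + 1)) : A) (copyL r l (s + 1)) (copyL r l (s + 2)) := by
      rw [Units.val_mul]
      exact SemiconjBy.mul_left (h.commute_copyL_of_gt le_rfl) (h.semiconj_copyL (s + 1))
    generalize r s * r (s + 1) = v at *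
    have a1 := u.mul_right (u1.mul_right u2)
    have a2 := (u1.mul_right u2).mul_right u
    rw [ih.eq] at a1
    have := a1.eq.symm.trans a2.eq
    exact v.isUnit.mul_right_cancel this

lemma prodL_mem (s j : ℕ) : prodL r l s j ∈ F (s + j) := by
  induction j with
  | zero => exact one_mem _
  | succ j ih => exact mul_mem (h.mono (by omega) ih) (h.copyL_mem _)

lemma commute_prodL {s k : ℕ} (hs : s + 1 < k) : Commute (r s : A) (prodL r l 0 k) := by
  induction k, hs using Nat.le_induction with
  | base =>
    have hm := h.prodL_mem 0 s
    rw [zero_add] at hm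
    simp only [prodL, zero_add, mul_assoc]
    exact (h.r_comm hm).mul_right (h.commute_copyL_mul s)
  | succ k hk ih =>
    rw [prodL, zero_add]
    exact ih.mul_right (h.commute_copyL_of_gt hk)

lemma ascProd_mem (s n : ℕ) :
    (ascProd r s n : A) ∈ F (s + n + 1) ∧ (↑(ascProd r s n)⁻¹ : A) ∈ F (s + n + 1) := by
  induction n with
  | zero => simp [ascProd]
  | succ n ih =>
    simp only [ascProd, mul_inv_rev, Units.val_mul]
    have := h.mono (show s + n + 1 ≤ s + (n + 1) + 1 by omega)
    exact ⟨mul_mem (this ih.1) (h.r_mem _), mul_mem (h.inv_mem _) (this ih.2)⟩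

/-- Only the adjacent pair r_{s+i} r_{s+i+1} of the product acts, by the braid relation; the factors
on either side commute with the generator they meet. Conjugation by r_s ⋯ r_{s+n-1} is thus a shift
by one site. -/
lemma semiconj_ascProd_r (s : ℕ) {n i : ℕ} (hi : i + 1 < n) :
    SemiconjBy (ascProd r s n) (r (s + i)) (r (s + 1 + i)) := by
  have hi' := hi
  induction n, hi' using Nat.le_induction with
  | base =>
    have hb : SemiconjBy (r (s + i) * r (s + i + 1)) (r (s + i)) (r (s + i + 1)) := by
      rw [SemiconjBy, h.braid, mul_assoc]
    have hc : Commute (ascProd r s i) (r (s + i + 1)) := by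
      have := h.r_comm (k := s + i + 1) (h.ascProd_mem s i).1
      exact Units.ext this.symm.eq
    rw [show s + 1 + i = s + i + 1 by omega]
    simp only [ascProd, mul_assoc]
    exact SemiconjBy.mul_left hc hb
  | succ n hn ih =>
    rw [ascProd]
    exact (ih hn).mul_left (h.commute_r (by omega))

lemma semiconj_ascProd_copyL (s : ℕ) {n i : ℕ} (hi : i < n) :
    SemiconjBy (ascProd r s n : A) (copyL r l (s + i)) (copyL r l (s + 1 + i)) := by
  have hi' := hi
  induction n, hi' using Nat.le_induction with
  | base =>
    have hc : ∀ m, m ≤ i → Commute (ascProd r s m : A) (copyL r l (s + i + 1)) := by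
      intro m
      induction m with
      | zero => intro _; simp [ascProd]
      | succ m ih =>
        intro hm
        rw [ascProd, Units.val_mul]
        exact (ih (by omega)).mul_left (h.commute_copyL_of_gt (by omega))
    rw [show s + 1 + i = s + i + 1 by omega]
    simp only [ascProd, Units.val_mul]
    exact SemiconjBy.mul_left (hc i le_rfl) (h.semiconj_copyL _)
  | succ n hn ih =>
    rw [ascProd, Units.val_mul]
    exact (ih hn).mul_left (h.commute_copyL_of_lt (by omega))

/-- The last generator of the product is absorbed by the innermost trace through `E_conj`; the
shorter product lies in a smaller algebra and passes outside that trace. -/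
lemma iterE_conj (s n : ℕ) {x : A} (hx : x ∈ F (s + n)) :
    iterE E (s + 1) n (ascProd r s n * x * ↑(ascProd r s n)⁻¹) = iterE E s n x := by
  induction n generalizing x with
  | zero => simp [ascProd, iterE]
  | succ n ih =>
    simp only [iterE, LinearMap.comp_apply]
    have hm := h.ascProd_mem s n
    have e : (ascProd r s (n + 1) : A) * x * ↑(ascProd r s (n + 1))⁻¹ =
        ascProd r s n * (r (s + n) * x * ↑(r (s + n))⁻¹ * ↑(ascProd r s n)⁻¹) := by
      simp [ascProd, mul_assoc]
    rw [e, show s + 1 + n = s + n + 1 by omega, h.E_left hm.1, h.E_right hm.2,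
      h.E_conj (show x ∈ F (s + n + 1) from hx), ← mul_assoc, ih (h.E_mem hx)]

lemma iterE_left (s j : ℕ) {y : A} (hy : y ∈ F s) (x : A) :
    iterE E s j (y * x) = y * iterE E s j x := by
  induction j generalizing x with
  | zero => rfl
  | succ j ih => simp [iterE, h.E_left (h.mono (Nat.le_add_right s j) hy), ih]

lemma iterE_right (s j : ℕ) {y : A} (hy : y ∈ F s) (x : A) :
    iterE E s j (x * y) = iterE E s j x * y := by
  induction j generalizing x with
  | zero => rfl
  | succ j ih => simp [iterE, h.E_right (h.mono (Nat.le_add_right s j) hy), ih]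

lemma iterE_mem (s j : ℕ) {x : A} (hx : x ∈ F (s + j)) : iterE E s j x ∈ F s := by
  induction j generalizing x with
  | zero => exact hx
  | succ j ih => exact ih (h.E_mem hx)

/-! ### Shift invariance and multiplicativity of brackets. -/

section Powers

variable (z : ℤ)

lemma descProd_mem (s n : ℕ) : (descProd (fun k => r k ^ z) s n : A) ∈ F (s + n + 1) := by
  induction n with
  | zero => exact one_mem _
  | succ n ih =>
    rw [descProd, Units.val_mul]
    exact mul_mem (h.zpow_mem _ z) (h.mono (by omega) ih)

lemma semiconj_descProd (s : ℕ) {n m : ℕ} (hm : m < n) :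
    SemiconjBy (ascProd r s n) (descProd (fun k => r k ^ z) s m)
      (descProd (fun k => r k ^ z) (s + 1) m) := by
  induction m with
  | zero => exact SemiconjBy.one_right _
  | succ m ih =>
    rw [descProd, descProd]
    exact ((h.semiconj_ascProd_r s hm).zpow_right z).mul_right (ih (by omega))

lemma semiconj_prodL (s : ℕ) {n m : ℕ} (hm : m ≤ n) :
    SemiconjBy (ascProd r s n : A) (prodL r l s m) (prodL r l (s + 1) m) := by
  induction m with
  | zero => exact SemiconjBy.one_right _
  | succ m ih =>
    rw [prodL, prodL]
    exact (ih (by omega)).mul_right (h.semiconj_ascProd_copyL s hm)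

/-- Conjugation by an ascending product shifts the braid word, the copies of L and the traces at
once, so the value does not depend on s. At s = 0 the value lies in `F 0`, hence behaves as a
constant for every trace. -/
lemma iterE_shift (s n : ℕ) :
    iterE E s (n + 1) (descProd (fun k => r k ^ z) s n * prodL r l s (n + 1)) =
      brk E r l (n + 1) (descProd (fun k => r k ^ z) 0 n) := by
  induction s with
  | zero => rfl
  | succ s ih =>
    rw [← ih, ← h.iterE_conj s (n + 1)]
    · have h1 : SemiconjBy (ascProd r s (n + 1) : A) (descProd (fun k => r k ^ z) s n)
          (descProd (fun k => r k ^ z) (s + 1) n) :=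
        congrArg Units.val (h.semiconj_descProd z s (Nat.lt_succ_self n)).eq
      have h2 := h1.mul_right (h.semiconj_prodL s (le_refl (n + 1)))
      rw [h2.eq, mul_assoc _ _ (↑(ascProd r s (n + 1))⁻¹ : A), Units.mul_inv, mul_one]
    · exact mul_mem (h.descProd_mem z s n) (h.prodL_mem s (n + 1))

lemma descProd_commute (s n : ℕ) {x : A} (hx : x ∈ F s) :
    Commute (descProd (fun k => r k ^ z) s n : A) x := by
  induction n with
  | zero => exact Commute.one_left _
  | succ n ih =>
    rw [descProd, Units.val_mul]
    exact (h.zpow_comm (h.mono (Nat.le_add_right s n) hx) z).mul_left ih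

/-- The bracket of a product of operators in disjoint sets of factors is a product. -/
lemma brk_mul (i n : ℕ) {y : A} (hy : y ∈ F i) :
    brk E r l (i + (n + 1)) (y * descProd (fun k => r k ^ z) i n) =
      brk E r l i y * brk E r l (n + 1) (descProd (fun k => r k ^ z) 0 n) := by
  have hL : prodL r l 0 i ∈ F i := by simpa using h.prodL_mem 0 i
  -- The descending word commutes past the first i copies of L. The traces over the factors from i
  -- on then see only the second block and turn it into an element of `F 0`, which leaves the
  -- remaining traces on the right.
  rw [← h.iterE_shift z i n, brk, iterE_add, prodL_add, mul_assoc, ← mul_assoc _ (prodL r l 0 i),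
    (h.descProd_commute z i n hL).eq, mul_assoc, ← mul_assoc, h.iterE_left i _ (mul_mem hy hL),
    brk, h.iterE_right]
  rw [h.iterE_shift]
  apply h.iterE_mem
  have h1 := h.descProd_mem z 0 n
  have h2 := h.prodL_mem 0 (n + 1)
  rw [zero_add] at h1 h2
  rw [zero_add]
  exact mul_mem h1 h2

end Powers

/-! ### Cyclicity of the bracket. -/

omit h in
/-- The elements that can be moved cyclically in the bracket. -/
def cyclic (E : ℕ → A →ₗ[ℂ] A) (r : ℕ → Aˣ) (l : A) (k : ℕ) : Subalgebra ℂ A where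
  carrier := {y | (∀ x, iterE E 0 k (y * x) = iterE E 0 k (x * y)) ∧ Commute y (prodL r l 0 k)}
  mul_mem' := by
    rintro a b ⟨ha, ha'⟩ ⟨hb, hb'⟩
    exact ⟨fun x => by rw [mul_assoc, ha, mul_assoc, hb, mul_assoc], ha'.mul_left hb'⟩
  add_mem' := by
    rintro a b ⟨ha, ha'⟩ ⟨hb, hb'⟩
    exact ⟨fun x => by rw [add_mul, mul_add, map_add, map_add, ha, hb], ha'.add_left hb'⟩
  algebraMap_mem' c := ⟨fun x => by rw [Algebra.commutes], Algebra.commute_algebraMap_left c _⟩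

omit h in
lemma brk_comm {k : ℕ} {y : A} (hy : y ∈ cyclic E r l k) (x : A) :
    brk E r l k (y * x) = brk E r l k (x * y) := by
  rw [brk, brk, mul_assoc, hy.1, mul_assoc, mul_assoc, hy.2.eq]

/-- When r_s acts in the last two factors, the two innermost traces give cyclicity by `E_cyc`; any
later factor is traced out first, and r_s passes through that trace. -/
lemma r_mem_cyclic {s k : ℕ} (hs : s + 1 < k) : (r s : A) ∈ cyclic E r l k := by
  refine ⟨?_, h.commute_prodL hs⟩
  induction k, hs using Nat.le_induction with
  | base =>
    intro x
    simp only [iterE, LinearMap.comp_apply, zero_add, h.E_cyc]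
  | succ k hk ih =>
    intro x
    have hm := h.mono (show s + 2 ≤ k from hk) (h.r_mem s)
    simp only [iterE, LinearMap.comp_apply, zero_add, h.E_left hm, h.E_right hm]
    exact ih _

lemma inv_mem_cyclic {s k : ℕ} (hs : s + 1 < k) : (↑(r s)⁻¹ : A) ∈ cyclic E r l k := by
  refine ⟨fun x => ?_, (h.commute_prodL hs).units_inv_left⟩
  have := (h.r_mem_cyclic hs).1 (↑(r s)⁻¹ * x * ↑(r s)⁻¹)
  simp only [mul_assoc, Units.mul_inv_cancel_left, Units.inv_mul, mul_one] at this
  exact this.symm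

/-! ### Antisymmetrizers and the Newton step. -/

section Hecke

variable {q : ℂ}

lemma asym_mem (i : ℕ) : asym q r i ∈ F (i + 1) := by
  induction i with
  | zero => exact one_mem _
  | succ i ih =>
    have := h.mono (Nat.le_succ (i + 1)) ih
    exact Subalgebra.smul_mem _ (mul_mem (mul_mem this (sub_mem (Subalgebra.smul_mem _
      (one_mem _) _) (Subalgebra.smul_mem _ (h.r_mem i) _))) this) _

lemma asym_mem_cyclic {i k : ℕ} (hi : i < k) : asym q r i ∈ cyclic E r l k := by
  induction i with
  | zero => exact one_mem _
  | succ i ih =>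
    have := ih (by omega)
    exact Subalgebra.smul_mem _ (mul_mem (mul_mem this (sub_mem (Subalgebra.smul_mem _
      (one_mem _) _) (Subalgebra.smul_mem _ (h.r_mem_cyclic hi) _))) this) _

/-- The recursion for `⟨A^(i+1) t_{i+n} ⋯ t_{i+1} L̄_1 ⋯⟩`, where `t_k` is `R_k` or its inverse. -/
lemma newton_step (z : ℤ) (hz : z = 1 ∨ z = -1) (c : ℂ) (i n : ℕ) (hqi : qNum q (i + 2) ≠ 0)
    (hA : asym q r i * asym q r i = asym q r i)
    (hrec : asym q r (i + 1) = (qNum q (i + 2))⁻¹ • (asym q r i *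
      (c • (1 : A) - qNum q (i + 1) • (↑(r i ^ z) : A)) * asym q r i)) :
    qNum q (i + 2) • brk E r l (i + 1 + n + 1)
        (asym q r (i + 1) * descProd (fun k => r k ^ z) (i + 1) n) =
      c • (brk E r l (i + 1) (asym q r i) * brk E r l (n + 1) (descProd (fun k => r k ^ z) 0 n)) -
      qNum q (i + 1) • brk E r l (i + (n + 1) + 1)
        (asym q r i * descProd (fun k => r k ^ z) i (n + 1)) := by
  have lin : ∀ k (a : ℂ) (x y : A), brk E r l k (a • x) = a • brk E r l k x ∧
      brk E r l k (x - y) = brk E r l k x - brk E r l k y := by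
    intro k a x y
    simp [brk, sub_mul]
  rw [← h.brk_mul z (i + 1) n (h.asym_mem i), hrec, smul_mul_assoc, (lin _ _ _ 0).1,
    smul_inv_smul₀ hqi, show i + (n + 1) + 1 = i + 1 + n + 1 by omega, descProd_succ']
  have hc := (h.descProd_commute z (i + 1) n (h.asym_mem (q := q) i)).eq
  have hcyc := h.asym_mem_cyclic (q := q) (show i < i + 1 + n + 1 by omega)
  have hz' : (↑(r i ^ z) : A) ∈ cyclic E r l (i + 1 + n + 1) := by
    rcases hz with rfl | rfl
    · simpa using h.r_mem_cyclic (show i + 1 < i + 1 + n + 1 by omega)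
    · simpa using h.inv_mem_cyclic (show i + 1 < i + 1 + n + 1 by omega)
  -- The scalar term contributes the bracket of A D, where A = `asym q r i` and D is the word
  -- starting at i + 1; it has already been matched with the product on the right by `brk_mul`.
  rw [mul_sub, sub_mul, sub_mul, (lin _ 0 _ _).2, mul_smul_comm, mul_one, smul_mul_assoc, hA,
    smul_mul_assoc, (lin _ c _ 0).1, mul_smul_comm, smul_mul_assoc, smul_mul_assoc,
    (lin _ (qNum q (i + 1)) _ 0).1, ← add_assoc (i + 1) n 1]
  congr 2
  -- It remains to turn A r_i^z A D into A D r_i^z. The second A commutes with D, goes round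
  -- cyclically and merges with the first by idempotency; cyclicity then carries r_i^z behind D.
  rw [mul_assoc (asym q r i * _), ← hc, ← mul_assoc, ← brk_comm hcyc, ← mul_assoc, ← mul_assoc,
    hA, mul_assoc, brk_comm (y := asym q r i) hcyc, mul_assoc, brk_comm hz', mul_assoc,
    ← mul_assoc, hc, mul_assoc, Units.val_mul]

omit h in
lemma inv_eq_sub (hr : ∀ k, (r k : A) * r k = (q - q⁻¹) • (r k : A) + 1) (k : ℕ) :
    (↑(r k)⁻¹ : A) = r k - (q - q⁻¹) • (1 : A) := by
  refine Units.inv_eq_of_mul_eq_one_right ?_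
  rw [mul_sub, hr]
  simp

variable (hq0 : q ≠ 0) (hq : ∀ k : ℕ, 1 ≤ k → q ^ k ≠ 1)
  (hr : ∀ k, (r k : A) * r k = (q - q⁻¹) • (r k : A) + 1)
include hq0 hq hr

/-- Generators with s < i - 1 are inherited from the previous antisymmetrizer, which is the
right-hand factor of the definition. The newest generator needs the braid relation and the Hecke
condition, and reaches back two steps; hence the strong induction. -/
lemma asym_spec (i : ℕ) : asym q r i * asym q r i = asym q r i ∧
    ∀ s < i, asym q r i * (r s : A) = -q⁻¹ • asym q r i := by
  have hω := sub_inv_ne_zero hq0 hq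
  induction i using Nat.strong_induction_on with
  | _ i IH =>
  rcases i with _ | i
  · simp [asym]
  obtain ⟨hA, hAr⟩ := IH i (Nat.lt_succ_self i)
  have hne : qNum q (i + 2) ≠ 0 := qNum_ne_zero hq0 hq (by omega)
  have last : asym q r (i + 1) * (r i : A) = -q⁻¹ • asym q r (i + 1) := by
    have hrec : asym q r (i + 1) = (qNum q (i + 2))⁻¹ • (q ^ (i + 1) • asym q r i -
        qNum q (i + 1) • (asym q r i * r i * asym q r i)) := by
      rw [asym]
      congr 1
      simp only [mul_sub, sub_mul, mul_smul_comm, smul_mul_assoc, mul_one, hA]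
    rw [hrec, smul_mul_assoc, smul_comm]
    congr 1
    rcases i with _ | j
    · have h0 : asym q r 0 = (1 : A) := rfl
      simp only [h0, sub_mul, smul_mul_assoc, one_mul, mul_one, hr, zero_add, qNum_one hω]
      match_scalars <;> field_simp
      ring
    · obtain ⟨hB, -⟩ := IH j (by omega)
      have hk : qNum q (j + 2) ≠ 0 := qNum_ne_zero hq0 hq (by omega)
      have hBr : Commute (r (j + 1) : A) (asym q r j) := h.r_comm (h.asym_mem j)
      have hbr : (r (j + 1) : A) * r j * r (j + 1) = r j * r (j + 1) * r j := by
        have := congrArg Units.val (h.braid j)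
        simpa using this.symm
      have hArj := hAr j (Nat.lt_succ_self j)
      have hAB : asym q r (j + 1) * asym q r j = asym q r (j + 1) := by
        rw [asym, smul_mul_assoc, mul_assoc, hB]
      have hk2 : qNum q (j + 2) • asym q r (j + 1) = asym q r j *
          (q ^ (j + 1) • (1 : A) - qNum q (j + 1) • (r j : A)) * asym q r j := by
        rw [asym, smul_inv_smul₀ hk]
      have huu := hr (j + 1)
      generalize asym q r (j + 1) = a at *
      generalize asym q r j = b at *
      generalize (r (j + 1) : A) = u at *
      generalize (r j : A) = v at *
      have hauB : a * u * b = a * u := by rw [mul_assoc, hBr.eq, ← mul_assoc, hAB]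
      -- Only the right-hand a of a u a is expanded, through b and v. The left-hand one absorbs b,
      -- because b commutes with u and a b = a.
      have d1 : qNum q (j + 2) • (a * u * a) =
          q ^ (j + 1) • (a * u) - qNum q (j + 1) • (a * u * v * b) := by
        rw [← mul_smul_comm, hk2]
        simp only [mul_sub, sub_mul, mul_smul_comm, smul_mul_assoc, mul_one, ← mul_assoc, hauB]
      have d2 : qNum q (j + 2) • (a * u * a * u) = q ^ (j + 1) • ((q - q⁻¹) • (a * u) + a) +
          (q⁻¹ * qNum q (j + 1)) • (a * u * v * b) := by
        -- The letter u moves past b, and u v u = v u v brings v next to a, where it acts by -q⁻¹.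
        have e1 : a * u * v * b * u = -q⁻¹ • (a * u * v * b) := by
          calc a * u * v * b * u = a * (u * v * u) * b := by
                simp only [mul_assoc, hBr.eq]
            _ = (a * v) * u * v * b := by rw [hbr]; simp only [mul_assoc]
            _ = _ := by rw [hArj]; simp only [smul_mul_assoc]
        rw [← smul_mul_assoc, d1, sub_mul, smul_mul_assoc, smul_mul_assoc, e1, mul_assoc a u u,
          huu, mul_add, mul_one, mul_smul_comm]
        module
      have hq' : q ^ (j + 1 + 1) = q * q ^ (j + 1) := by ring
      rw [sub_mul, smul_mul_assoc, smul_mul_assoc, d2, d1, hq']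
      match_scalars <;> field_simp <;> ring
  have hlt : ∀ s < i + 1, asym q r (i + 1) * (r s : A) = -q⁻¹ • asym q r (i + 1) := by
    intro s hs
    rcases Nat.lt_succ_iff_lt_or_eq.mp hs with hs | rfl
    · rw [asym, smul_mul_assoc, mul_assoc, hAr s hs, mul_smul_comm, smul_comm]
    · exact last
  refine ⟨?_, hlt⟩
  have hAA : asym q r (i + 1) * asym q r i = asym q r (i + 1) := by
    rw [asym, smul_mul_assoc, mul_assoc, hA]
  have hdef : asym q r (i + 1) = (qNum q (i + 2))⁻¹ • (asym q r i *
      (q ^ (i + 1) • (1 : A) - qNum q (i + 1) • (r i : A)) * asym q r i) := rfl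
  rw [show asym q r (i + 1) * asym q r (i + 1) = asym q r (i + 1) * _ from
    congrArg (asym q r (i + 1) * ·) hdef]
  rw [mul_smul_comm, ← mul_assoc, ← mul_assoc, hAA, mul_sub, mul_smul_comm, mul_one,
    mul_smul_comm, last, sub_mul, smul_mul_assoc, smul_mul_assoc, smul_mul_assoc, hAA,
    smul_smul, ← sub_smul, smul_smul]
  -- With r_i acting by -q⁻¹, the middle factor of the second copy becomes this scalar; it cancels
  -- the normalisation of the antisymmetrizer.
  have : q ^ (i + 1) - qNum q (i + 1) * -q⁻¹ = qNum q (i + 2) := by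
    rw [qNum_succ hq0 hω (i + 1)]; ring
  rw [this, inv_mul_cancel₀ hne, one_smul]

lemma newton_step_one (i n : ℕ) :
    qNum q (i + 2) • brk E r l (i + 1 + n + 1)
        (asym q r (i + 1) * descProd (fun k => r k ^ (1 : ℤ)) (i + 1) n) =
      q ^ (i + 1) • (brk E r l (i + 1) (asym q r i) *
        brk E r l (n + 1) (descProd (fun k => r k ^ (1 : ℤ)) 0 n)) -
      qNum q (i + 1) • brk E r l (i + (n + 1) + 1)
        (asym q r i * descProd (fun k => r k ^ (1 : ℤ)) i (n + 1)) := by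
  refine h.newton_step 1 (Or.inl rfl) _ i n (qNum_ne_zero hq0 hq (by omega))
    (h.asym_spec hq0 hq hr i).1 ?_
  simp [asym]

/-- Substituting r_i = r_i⁻¹ + ω in the antisymmetrizer changes the scalar q^{i+1} into q^{i+1} - ω
(i+1)_q = q^{-(i+1)}. -/
lemma newton_step_neg_one (i n : ℕ) :
    qNum q (i + 2) • brk E r l (i + 1 + n + 1)
        (asym q r (i + 1) * descProd (fun k => r k ^ (-1 : ℤ)) (i + 1) n) =
      q⁻¹ ^ (i + 1) • (brk E r l (i + 1) (asym q r i) *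
        brk E r l (n + 1) (descProd (fun k => r k ^ (-1 : ℤ)) 0 n)) -
      qNum q (i + 1) • brk E r l (i + (n + 1) + 1)
        (asym q r i * descProd (fun k => r k ^ (-1 : ℤ)) i (n + 1)) := by
  refine h.newton_step (-1) (Or.inr rfl) _ i n (qNum_ne_zero hq0 hq (by omega))
    (h.asym_spec hq0 hq hr i).1 ?_
  rw [asym, zpow_neg_one, inv_eq_sub hr]
  congr 3
  have : q⁻¹ ^ (i + 1) = q ^ (i + 1) - (q - q⁻¹) * qNum q (i + 1) := by
    rw [mul_qNum (sub_inv_ne_zero hq0 hq)]; ring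
  rw [this]
  module

end Hecke

end IsTower

/-- Unrolling of the Newton recursion. -/
lemma sum_of_newton_step {B : Type*} [Ring B] [Algebra ℂ B] (κ c : ℕ → ℂ) (Y : ℕ → ℕ → B)
    (a p : ℕ → B) (hκ : κ 1 = 1) (hc : c 0 = 1) (ha0 : a 0 = 1) (ha : ∀ i, a (i + 1) = Y i 0)
    (hp : ∀ n, p (n + 1) = Y 0 n)
    (hY : ∀ i n, κ (i + 2) • Y (i + 1) n = c (i + 1) • (Y i 0 * Y 0 n) -
      κ (i + 1) • Y i (n + 1)) (k : ℕ) :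
    κ (k + 1) • a (k + 1) =
      ∑ i ∈ range (k + 1), ((-1) ^ (k - i) * c i) • (a i * p (k + 1 - i)) := by
  -- The statement covers all n, since the step to `Y (j + 1) n` uses `Y j (n + 1)`.
  have key : ∀ j n, κ (j + 1) • Y j n =
      ∑ i ∈ range (j + 1), ((-1) ^ (j - i) * c i) • (a i * p (j + n + 1 - i)) := by
    intro j
    induction j with
    | zero => intro n; simp [hκ, hc, ha0, hp]
    | succ j ih =>
      intro n
      rw [hY, ih, sum_range_succ _ (j + 1), ha, show j + 1 + n + 1 - (j + 1) = n + 1 by omega, hp,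
        sub_eq_neg_add, ← sum_neg_distrib]
      simp only [Nat.sub_self, pow_zero, one_mul]
      congr 1
      refine sum_congr rfl fun i hi => ?_
      have hi' : i ≤ j := Nat.lt_succ_iff.mp (mem_range.mp hi)
      rw [Nat.succ_sub hi', pow_succ, show j + 1 + n + 1 - i = j + (n + 1) + 1 - i by omega]
      module
  rw [ha, key]

/-! ### Operators on functions on infinite words -/

section Model

variable {N : ℕ} {S : Type*} [Ring S] [Algebra ℂ S]

/-- The operators on `S`-valued functions on infinite words. -/
abbrev Op (N : ℕ) (S : Type*) [Ring S] [Algebra ℂ S] : Type _ := Module.End ℂ ((ℕ → Fin N) → S)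

/-- The matrix units at the site `k`. -/
def unitOp (S : Type*) [Ring S] [Algebra ℂ S] (k : ℕ) (a b : Fin N) : Op N S where
  toFun f v := if v k = a then f (Function.update v k b) else 0
  map_add' f g := by ext v; simp only [Pi.add_apply]; split_ifs <;> simp
  map_smul' c f := by ext v; simp

lemma unitOp_apply (k : ℕ) (a b : Fin N) (f : (ℕ → Fin N) → S) (v : ℕ → Fin N) :
    unitOp S k a b f v = if v k = a then f (Function.update v k b) else 0 := rfl

lemma matrixUnits_unitOp : MatrixUnits (unitOp (N := N) S) where
  mul k a b c d := by
    ext f v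
    simp only [Module.End.mul_apply, unitOp_apply, Function.update_self, Function.update_idem]
    by_cases h : b = c <;> simp [h, unitOp_apply]
  sum k := by
    ext f v
    simp [LinearMap.sum_apply, Finset.sum_apply, unitOp_apply]
  comm i j hij a b c d := by
    ext f v
    simp only [Module.End.mul_apply, unitOp_apply]
    rw [Function.update_of_ne hij, Function.update_of_ne hij.symm, Function.update_comm hij]
    split_ifs <;> rfl

/-- Left multiplication by elements of `S`. -/
def mulOp (N : ℕ) (S : Type*) [Ring S] [Algebra ℂ S] : S →ₐ[ℂ] Op N S where
  toFun s := { toFun := fun f v => s * f v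
               map_add' := fun f g => by ext v; simp [mul_add]
               map_smul' := fun c f => by ext v; simp }
  map_one' := by ext f v; simp
  map_mul' s t := by ext f v; simp [mul_assoc]
  map_zero' := by ext f v; simp
  map_add' s t := by ext f v; simp [add_mul]
  commutes' c := by ext f v; simp [Algebra.algebraMap_eq_smul_one]

lemma mulOp_apply (s : S) (f : (ℕ → Fin N) → S) (v : ℕ → Fin N) : mulOp N S s f v = s * f v := rfl

/-- Evaluation on the constant function 1 recovers s, provided that a word exists; for N = 0 there
is none, and that case is treated apart. -/
lemma mulOp_injective (hN : 0 < N) : Function.Injective (mulOp N S) := by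
  intro s t h
  have := congrFun (LinearMap.congr_fun h fun _ => 1) fun _ => ⟨0, hN⟩
  simpa [mulOp_apply] using this

lemma mulOp_commute (s : S) (k : ℕ) (a b : Fin N) : Commute (mulOp N S s) (unitOp S k a b) := by
  ext f v
  simp [mulOp_apply, unitOp_apply]

/-- The matrices over `S` acting at the sites `f 0, f 1, …`. -/
noncomputable def matOp {n : ℕ} (f : Fin n → ℕ) (hf : Function.Injective f) :
    Matrix (Fin n → Fin N) (Fin n → Fin N) S →ₐ[ℂ] Op N S :=
  AlgHom.ofLinearMap
    { toFun := fun M =>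
        { toFun := fun φ v => ∑ w, M (v ∘ f) w * φ (Function.extend f w v)
          map_add' := fun φ ψ => by ext v; simp [mul_add, sum_add_distrib]
          map_smul' := fun c φ => by ext v; simp [smul_sum] }
      map_add' := fun M M' => by ext φ v; simp [add_mul, sum_add_distrib]
      map_smul' := fun c M => by ext φ v; simp [smul_sum] }
    (by
      ext φ v
      have : Function.extend f (v ∘ f) v = v := by
        funext k
        by_cases hk : ∃ i, f i = k
        · obtain ⟨i, rfl⟩ := hk
          rw [hf.extend_apply]; rfl
        · rw [Function.extend_apply' _ _ _ hk]
      simp [Matrix.one_apply, this])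
    (by
      intro M M'
      ext φ v
      have h1 : ∀ w : Fin n → Fin N, Function.extend f w v ∘ f = w := fun w => by
        funext i; simp [hf.extend_apply]
      have h2 : ∀ w u : Fin n → Fin N, Function.extend f u (Function.extend f w v) =
          Function.extend f u v := fun w u => by
        funext k
        by_cases hk : ∃ i, f i = k
        · obtain ⟨i, rfl⟩ := hk
          rw [hf.extend_apply, hf.extend_apply]
        · rw [Function.extend_apply' _ _ _ hk, Function.extend_apply' _ _ _ hk,
            Function.extend_apply' _ _ _ hk]
      simp only [LinearMap.coe_mk, AddHom.coe_mk, Module.End.mul_apply, h1, h2,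
        Matrix.mul_apply, sum_mul, mul_sum]
      rw [sum_comm]
      simp only [mul_assoc])

lemma matOp_apply {n : ℕ} (f : Fin n → ℕ) (hf : Function.Injective f)
    (M : Matrix (Fin n → Fin N) (Fin n → Fin N) S) (φ : (ℕ → Fin N) → S) (v : ℕ → Fin N) :
    matOp f hf M φ v = ∑ w, M (v ∘ f) w * φ (Function.extend f w v) := rfl

lemma pair_unitOp_apply {i j : ℕ} (hij : i ≠ j) (M : Matrix (Fin N × Fin N) (Fin N × Fin N) ℂ)
    (φ : (ℕ → Fin N) → S) (v : ℕ → Fin N) :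
    pair (unitOp S) i j M φ v = ∑ p, M (v i, v j) p •
      φ (Function.update (Function.update v i p.1) j p.2) := by
  simp only [pair, LinearMap.sum_apply, Finset.sum_apply, LinearMap.smul_apply, Pi.smul_apply,
    Module.End.mul_apply, unitOp_apply, Function.update_of_ne hij.symm]
  rw [sum_comm]
  refine sum_congr rfl fun p _ => ?_
  have : ∀ x : Fin N × Fin N, (M x p • if v i = x.1 then
      if v j = x.2 then φ (Function.update (Function.update v i p.1) j p.2) else 0 else 0) =
      if (v i, v j) = x then M x p • φ (Function.update (Function.update v i p.1) j p.2)
        else 0 := by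
    rintro ⟨x, y⟩
    by_cases h1 : v i = x <;> by_cases h2 : v j = y <;> simp [h1, h2]
  simp [this]

lemma matOp_twoSite {n : ℕ} (f : Fin (n + 1) → ℕ) (hf : Function.Injective f) (i : Fin n)
    (M : Matrix (Fin N × Fin N) (Fin N × Fin N) ℂ) :
    matOp f hf ((twoSite i M).map (algebraMap ℂ S)) =
      pair (unitOp S) (f i.castSucc) (f i.succ) M := by
  have hne : f i.castSucc ≠ f i.succ := fun h => (Fin.castSucc_lt_succ (i := i)).ne (hf h)
  have hmap : (twoSite i M).map (algebraMap ℂ S) = twoSite i (M.map (algebraMap ℂ S)) := by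
    ext v w
    simp only [twoSite, Matrix.map_apply, Matrix.of_apply]
    split_ifs <;> simp
  ext φ v
  rw [matOp_apply, hmap, sum_twoSite_mul, pair_unitOp_apply hne]
  refine sum_congr rfl fun p _ => ?_
  rw [Algebra.smul_def]
  congr 2
  funext k
  by_cases hk : ∃ s, f s = k
  · obtain ⟨s, rfl⟩ := hk
    simp [hf.extend_apply, Function.update_apply, hf.eq_iff]
  · have h1 : k ≠ f i.castSucc := fun h => hk ⟨_, h.symm⟩
    have h2 : k ≠ f i.succ := fun h => hk ⟨_, h.symm⟩
    simp [Function.extend_apply' _ _ _ hk, h1, h2]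

/-- The matrix `L` over `S` acting at the site `0`. -/
def firstOp (L : Matrix (Fin N) (Fin N) S) : Op N S :=
  ∑ a, ∑ b, mulOp N S (L a b) * unitOp S 0 a b

lemma firstOp_apply (L : Matrix (Fin N) (Fin N) S) (φ : (ℕ → Fin N) → S) (v : ℕ → Fin N) :
    firstOp L φ v = ∑ b, L (v 0) b * φ (Function.update v 0 b) := by
  simp [firstOp, LinearMap.sum_apply, Finset.sum_apply, mulOp_apply, unitOp_apply]

lemma matOp_oneSite {n : ℕ} (f : Fin (n + 1) → ℕ) (hf : Function.Injective f) (h0 : f 0 = 0)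
    (L : Matrix (Fin N) (Fin N) S) : matOp f hf (oneSite 0 L) = firstOp L := by
  ext φ v
  rw [matOp_apply, firstOp_apply]
  symm
  apply Fintype.sum_of_injective (fun b => Function.update (v ∘ f) 0 b)
  · intro a b h
    simpa using congrFun h 0
  · intro w hw
    have : ¬ ∀ k, k ≠ 0 → (v ∘ f) k = w k := by
      intro h
      refine hw ⟨w 0, ?_⟩
      funext k
      by_cases hk : k = 0
      · subst hk; simp
      · simp only [Function.update_of_ne hk, h k hk]
    simp only [oneSite, Matrix.of_apply, if_neg this, zero_mul]
  · intro b
    have h1 : ∀ k, k ≠ 0 → (v ∘ f) k = Function.update (v ∘ f) 0 b k := fun k hk => by simp [hk]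
    simp only [oneSite, Matrix.of_apply, if_pos h1]
    congr 1
    · simp [h0]
    · congr 1
      funext k
      by_cases hk : ∃ s, f s = k
      · obtain ⟨s, rfl⟩ := hk
        rw [hf.extend_apply]
        have : f s = 0 ↔ s = 0 := by rw [← hf.eq_iff, h0]
        simp [Function.update_apply, this]
      · have h1 : k ≠ 0 := fun h => hk ⟨0, by rw [h0, h]⟩
        rw [Function.extend_apply' _ _ _ hk]
        simp [h1]

/-- The partial trace over the last factor, weighted by `C`. -/
def lastTr (C : Matrix (Fin N) (Fin N) ℂ) {n : ℕ}
    (M : Matrix (Fin (n + 1) → Fin N) (Fin (n + 1) → Fin N) S) :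
    Matrix (Fin n → Fin N) (Fin n → Fin N) S :=
  .of fun v w => ∑ a, ∑ b, C a b • M (Fin.snoc v b) (Fin.snoc w a)

lemma trace_tensorPow_mul (C : Matrix (Fin N) (Fin N) ℂ) {n : ℕ}
    (M : Matrix (Fin n → Fin N) (Fin n → Fin N) S) :
    ((tensorPow C n).map (algebraMap ℂ S) * M).trace =
      ∑ v, ∑ w, tensorPow C n v w • M w v := by
  simp [Matrix.trace, Matrix.mul_apply, Algebra.smul_def]

lemma sum_snoc {T : Type*} [AddCommMonoid T] {n : ℕ} (g : (Fin (n + 1) → Fin N) → T) :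
    ∑ v, g v = ∑ v : Fin n → Fin N, ∑ a, g (Fin.snoc v a) := by
  rw [← (Fin.snocEquiv fun _ : Fin (n + 1) => Fin N).sum_comp, Fintype.sum_prod_type, sum_comm]
  rfl

lemma trace_tensorPow_succ (C : Matrix (Fin N) (Fin N) ℂ) {n : ℕ}
    (M : Matrix (Fin (n + 1) → Fin N) (Fin (n + 1) → Fin N) S) :
    ((tensorPow C (n + 1)).map (algebraMap ℂ S) * M).trace =
      ((tensorPow C n).map (algebraMap ℂ S) * lastTr C M).trace := by
  rw [trace_tensorPow_mul, trace_tensorPow_mul, sum_snoc]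
  refine sum_congr rfl fun v _ => ?_
  simp only [sum_snoc (n := n)]
  rw [sum_comm]
  refine sum_congr rfl fun w _ => ?_
  simp only [lastTr, Matrix.of_apply, smul_sum, smul_smul]
  refine sum_congr rfl fun a _ => sum_congr rfl fun b _ => ?_
  congr 1
  simp [tensorPow, Fin.prod_univ_castSucc]

lemma wtr_unitOp_apply (C : Matrix (Fin N) (Fin N) ℂ) (k : ℕ) (X : Op N S)
    (φ : (ℕ → Fin N) → S) (v : ℕ → Fin N) :
    wtr (unitOp S) C k X φ v = ∑ a, ∑ b, C a b •
      X (unitOp S k a (v k) φ) (Function.update v k b) := by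
  have h : ∀ p c, unitOp S k c p * site (unitOp S) k C = ∑ t, C p t • unitOp S k c t := by
    intro p c
    simp only [site, mul_sum, mul_smul_comm, matrixUnits_unitOp.mul]
    simp
  simp only [wtr_apply, ptr_apply, ← mul_assoc, h, sum_mul]
  simp only [LinearMap.sum_apply, Finset.sum_apply, smul_mul_assoc, LinearMap.smul_apply,
    Pi.smul_apply, Module.End.mul_apply]
  refine sum_congr rfl fun a _ => ?_
  rw [sum_comm]
  refine sum_congr rfl fun b _ => ?_
  rw [← smul_sum]
  congr 1
  simp [unitOp_apply (k := k) (b := b)]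

lemma wtr_matOp (C : Matrix (Fin N) (Fin N) ℂ) {n : ℕ}
    (M : Matrix (Fin (n + 1) → Fin N) (Fin (n + 1) → Fin N) S) :
    wtr (unitOp S) C n (matOp Fin.val Fin.val_injective M) =
      matOp Fin.val Fin.val_injective (lastTr C M) := by
  ext φ v
  rw [wtr_unitOp_apply, matOp_apply]
  simp only [matOp_apply, lastTr, Matrix.of_apply, sum_mul]
  rw [sum_comm (s := univ (α := Fin n → Fin N))]
  refine sum_congr rfl fun a _ => ?_
  rw [sum_comm (s := univ (α := Fin n → Fin N))]
  refine sum_congr rfl fun b _ => ?_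
  rw [smul_sum, sum_snoc]
  refine sum_congr rfl fun w _ => ?_
  have h1 : (Function.update v n b ∘ Fin.val : Fin (n + 1) → Fin N) =
      Fin.snoc (v ∘ Fin.val : Fin n → Fin N) b := by
    funext k
    refine Fin.lastCases ?_ (fun k => ?_) k
    · simp
    · simp [k.isLt.ne]
  have h2 : ∀ (w' : Fin (n + 1) → Fin N),
      Function.extend Fin.val w' (Function.update v n b) n = w' (Fin.last n) := fun w' => by
    have := (Fin.val_injective (n := n + 1)).extend_apply w' (Function.update v n b) (Fin.last n)
    simpa using this
  -- Resetting the letter n to its original value undoes both the added letter c and the update by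
  -- b, so that only the first n letters are replaced.
  have h3 : ∀ c, Function.update (Function.extend Fin.val (Fin.snoc w c : Fin (n + 1) → Fin N)
      (Function.update v n b)) n (v n) = Function.extend (Fin.val : Fin n → ℕ) w v := by
    intro c
    funext k
    by_cases hk : k = n
    · subst hk
      rw [Function.update_self, Function.extend_apply']
      rintro ⟨i, hi⟩
      exact i.isLt.ne hi
    rw [Function.update_of_ne hk]
    by_cases hk2 : k < n
    · have e1 := (Fin.val_injective (n := n + 1)).extend_apply (Fin.snoc w c : Fin (n + 1) → Fin N)
        (Function.update v n b) (Fin.castSucc ⟨k, hk2⟩)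
      have e2 := (Fin.val_injective (n := n)).extend_apply w v ⟨k, hk2⟩
      simp only [Fin.val_castSucc, Fin.snoc_castSucc] at e1 e2
      rw [e1, e2]
    · rw [Function.extend_apply', Function.extend_apply', Function.update_of_ne hk]
      · rintro ⟨i, rfl⟩; exact hk2 i.isLt
      · rintro ⟨i, rfl⟩; omega
  simp only [h1, unitOp_apply, h2, h3, Fin.snoc_last]
  simp

/-- Peeling off the last factor identifies the iterated operator traces with the full matrix trace
weighted by C^{⊗n}; the result is a multiplication operator. -/
lemma iterE_matOp (C : Matrix (Fin N) (Fin N) ℂ) {n : ℕ}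
    (M : Matrix (Fin n → Fin N) (Fin n → Fin N) S) :
    iterE (wtr (unitOp S) C) 0 n (matOp Fin.val Fin.val_injective M) =
      mulOp N S ((tensorPow C n).map (algebraMap ℂ S) * M).trace := by
  induction n with
  | zero =>
    rw [trace_tensorPow_mul]
    ext φ v
    have : ∀ w : Fin 0 → Fin N, Function.extend Fin.val w v = v := fun w => by
      funext k
      rw [Function.extend_apply']
      rintro ⟨i, -⟩
      exact i.elim0
    simp [iterE, matOp_apply, mulOp_apply, this, tensorPow, Subsingleton.elim _ (default : Fin 0 → Fin N)]
  | succ n ih =>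
    rw [trace_tensorPow_succ, ← ih, iterE, LinearMap.comp_apply, zero_add, wtr_matOp]

end Model

/-! ### Vanishing of the antisymmetrizers above the rank -/

section Vanishing

variable {N : ℕ}

/-- Tensoring with a basis vector on the left. -/
def consMap (a : Fin N) (n : ℕ) : ((Fin n → Fin N) → ℂ) →ₗ[ℂ] ((Fin (n + 1) → Fin N) → ℂ) where
  toFun f v := if v 0 = a then f (Fin.tail v) else 0
  map_add' f g := by ext v; simp only [Pi.add_apply]; split_ifs <;> simp
  map_smul' c f := by ext v; simp

lemma consMap_apply (a : Fin N) (n : ℕ) (f : (Fin n → Fin N) → ℂ) (v : Fin (n + 1) → Fin N) :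
    consMap a n f v = if v 0 = a then f (Fin.tail v) else 0 := rfl

/-- The degree `n` component of the ideal generated by the image of `M` in the tensor algebra. -/
def idealComp (M : Matrix (Fin N × Fin N) (Fin N × Fin N) ℂ) :
    (n : ℕ) → Submodule ℂ ((Fin n → Fin N) → ℂ)
  | 0 => ⊥
  | n + 1 => ⨆ i : Fin n, LinearMap.range (twoSite i M).mulVecLin

lemma consMap_mulVec (M : Matrix (Fin N × Fin N) (Fin N × Fin N) ℂ) (a : Fin N) {n : ℕ}
    (i : Fin n) (f : (Fin (n + 1) → Fin N) → ℂ) :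
    consMap a (n + 1) ((twoSite i M).mulVec f) =
      (twoSite i.succ M).mulVec (consMap a (n + 1) f) := by
  ext v
  simp only [consMap_apply, Matrix.mulVec, dotProduct]
  rw [sum_twoSite_mul, sum_twoSite_mul]
  have h0 : ∀ p : Fin N × Fin N, Function.update (Function.update v i.succ.castSucc p.1)
      i.succ.succ p.2 0 = v 0 := fun p => by
    rw [Function.update_of_ne (Fin.succ_ne_zero _).symm, Function.update_of_ne]
    rw [Fin.castSucc_succ]
    exact (Fin.succ_ne_zero _).symm
  have h1 : ∀ p : Fin N × Fin N, Fin.tail (Function.update (Function.update v i.succ.castSucc p.1)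
      i.succ.succ p.2) = Function.update (Function.update (Fin.tail v) i.castSucc p.1)
      i.succ p.2 := fun p => by
    rw [Fin.castSucc_succ, Fin.tail_update_succ, Fin.tail_update_succ]
  simp only [h0, h1]
  split_ifs
  · rfl
  · simp

lemma consMap_mem (M : Matrix (Fin N × Fin N) (Fin N × Fin N) ℂ) (a : Fin N) {n : ℕ}
    {f : (Fin n → Fin N) → ℂ} (hf : f ∈ idealComp M n) :
    consMap a n f ∈ idealComp M (n + 1) := by
  rcases n with _ | n
  · have : f = 0 := hf
    rw [this, map_zero]
    exact zero_mem _
  · have : idealComp M (n + 1) ≤ (idealComp M (n + 2)).comap (consMap a (n + 1)) := by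
      refine iSup_le fun i => ?_
      rintro _ ⟨g, rfl⟩
      rw [Submodule.mem_comap, Matrix.mulVecLin_apply, consMap_mulVec]
      exact Submodule.mem_iSup_of_mem i.succ ⟨_, rfl⟩
    exact this hf

/-- The completed tensor algebra as a vector space. -/
abbrev TensorSeq (N : ℕ) : Type := (n : ℕ) → ((Fin n → Fin N) → ℂ)

/-- Left multiplication by a basis vector in the completed tensor algebra. -/
def leftMul (a : Fin N) : TensorSeq N →ₗ[ℂ] TensorSeq N where
  toFun f
    | 0 => 0
    | n + 1 => consMap a n (f n)
  map_add' f g := by ext (_ | n) v <;> simp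
  map_smul' c f := by ext (_ | n) v <;> simp

/-- The ideal generated by the image of `M` in the completed tensor algebra. -/
def idealSeq (M : Matrix (Fin N × Fin N) (Fin N × Fin N) ℂ) : Submodule ℂ (TensorSeq N) :=
  Submodule.pi Set.univ (idealComp M)

lemma leftMul_mem (M : Matrix (Fin N × Fin N) (Fin N × Fin N) ℂ) (a : Fin N) :
    idealSeq M ≤ (idealSeq M).comap (leftMul a) := by
  intro f hf
  rintro (_ | n) -
  · exact zero_mem _
  · exact consMap_mem M a (hf n trivial)

/-- Left multiplication by a basis vector in the quotient. -/
noncomputable def leftMulQ (M : Matrix (Fin N × Fin N) (Fin N × Fin N) ℂ) (a : Fin N) :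
    Module.End ℂ (TensorSeq N ⧸ idealSeq M) :=
  (idealSeq M).mapQ (idealSeq M) (leftMul a) (leftMul_mem M a)

lemma leftMulQ_mk (M : Matrix (Fin N × Fin N) (Fin N × Fin N) ℂ) (a : Fin N) (f : TensorSeq N) :
    leftMulQ M a (Submodule.Quotient.mk f) = Submodule.Quotient.mk (leftMul a f) := rfl

/-- The sum is M applied in the first two factors to e_{j.1} ⊗ e_{j.2} ⊗ f, and its components of
degree 0 and 1 vanish. This makes left multiplication respect the defining relations. -/
lemma sum_leftMul_mem (M : Matrix (Fin N × Fin N) (Fin N × Fin N) ℂ) (j : Fin N × Fin N)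
    (f : TensorSeq N) :
    ∑ i : Fin N × Fin N, M i j • leftMul i.1 (leftMul i.2 f) ∈ idealSeq M := by
  rintro (_ | _ | n) -
  · simp [leftMul, idealComp]
  · have : (∑ i : Fin N × Fin N, M i j • leftMul i.1 (leftMul i.2 f)) 1 = 0 := by
      simp [leftMul]
    rw [this]; exact zero_mem _
  · refine Submodule.mem_iSup_of_mem 0 ⟨consMap j.1 (n + 1) (consMap j.2 n (f n)), ?_⟩
    ext v
    simp only [Matrix.mulVecLin_apply, Matrix.mulVec, dotProduct]
    rw [sum_twoSite_mul]
    have ht : ∀ p : Fin N × Fin N, Fin.tail (Fin.tail (Function.update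
        (Function.update v (0 : Fin (n + 1)).castSucc p.1) (0 : Fin (n + 1)).succ p.2)) =
        Fin.tail (Fin.tail v) := by
      intro p
      funext k
      simp only [Fin.tail]
      rw [Function.update_of_ne, Function.update_of_ne]
      · exact Fin.succ_ne_zero _
      · intro h
        exact Fin.succ_ne_zero _ (Fin.succ_injective _ h)
    have hs : ∀ p : Fin N × Fin N, Fin.tail (Function.update
        (Function.update v (0 : Fin (n + 1)).castSucc p.1) (0 : Fin (n + 1)).succ p.2) 0 =
        p.2 := fun p => Function.update_self ..
    have hz : ∀ p : Fin N × Fin N, Function.update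
        (Function.update v (0 : Fin (n + 1)).castSucc p.1) (0 : Fin (n + 1)).succ p.2 0 =
        p.1 := fun p => by
      rw [Function.update_of_ne (Fin.succ_ne_zero _).symm]
      exact Function.update_self ..
    simp only [consMap_apply, ht, hs, hz, Finset.sum_apply, Pi.smul_apply, leftMul,
      LinearMap.coe_mk, AddHom.coe_mk, smul_eq_mul]
    have e1 : ∀ p : Fin N × Fin N, (M (v (0 : Fin (n + 1)).castSucc, v (0 : Fin (n + 1)).succ) p *
        if p.1 = j.1 then if p.2 = j.2 then f n (Fin.tail (Fin.tail v)) else 0 else 0) =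
        if p = j then M (v 0, v 1) j * f n (Fin.tail (Fin.tail v)) else 0 := by
      rintro ⟨p, p'⟩
      by_cases h1 : p = j.1 <;> by_cases h2 : p' = j.2 <;> simp [h1, h2, Prod.ext_iff]
    have e2 : ∀ p : Fin N × Fin N, (M p j *
        if v 0 = p.1 then if Fin.tail v 0 = p.2 then f n (Fin.tail (Fin.tail v)) else 0 else 0) =
        if (v 0, v 1) = p then M (v 0, v 1) j * f n (Fin.tail (Fin.tail v)) else 0 := by
      rintro ⟨p, p'⟩
      have : Fin.tail v 0 = v 1 := rfl
      rw [this]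
      by_cases h1 : v 0 = p <;> by_cases h2 : v 1 = p' <;> simp [h1, h2]
    simp only [e1, e2]
    simp

variable (q : ℂ) (R : Matrix (Fin N × Fin N) (Fin N × Fin N) ℂ)

/-- The action of the skew-symmetric algebra on the quotient of the completed tensor algebra. -/
noncomputable def skewAction : SkewAlgebra q R →ₐ[ℂ] Module.End ℂ (TensorSeq N ⧸
    idealSeq (q⁻¹ • (1 : Matrix (Fin N × Fin N) (Fin N × Fin N) ℂ) + R)) :=
  RingQuot.liftAlgHom ℂ ⟨FreeAlgebra.lift ℂ (leftMulQ _), by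
    rintro _ _ ⟨j⟩
    rw [map_zero]
    refine LinearMap.ext fun x => ?_
    obtain ⟨f, rfl⟩ := Submodule.Quotient.mk_surjective _ x
    simp only [map_sum, map_smul, map_mul, FreeAlgebra.lift_ι_apply, LinearMap.sum_apply,
      LinearMap.smul_apply, Module.End.mul_apply, leftMulQ_mk, LinearMap.zero_apply]
    have h := (Submodule.Quotient.mk_eq_zero _).mpr
      (sum_leftMul_mem (q⁻¹ • (1 : Matrix (Fin N × Fin N) (Fin N × Fin N) ℂ) + R) j f)
    rw [← h, ← Submodule.mkQ_apply, map_sum]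
    simp only [map_smul, Submodule.mkQ_apply]⟩

lemma skewAction_ι (a : Fin N) :
    skewAction q R (RingQuot.mkAlgHom ℂ (SkewRel q R) (FreeAlgebra.ι ℂ a)) = leftMulQ _ a := by
  simp [skewAction]

/-- The basis vector of a word, as an element of the completed tensor algebra. -/
def wordSeq {n : ℕ} (v : Fin n → Fin N) : TensorSeq N := Pi.single n (Pi.single v 1)

lemma leftMul_wordSeq {n : ℕ} (a : Fin N) (v : Fin n → Fin N) :
    leftMul a (wordSeq v) = wordSeq (Fin.cons a v : Fin (n + 1) → Fin N) := by
  funext k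
  rcases k with _ | k
  · simp [leftMul, wordSeq]
  · by_cases hk : k = n
    · subst hk
      simp only [leftMul, wordSeq, LinearMap.coe_mk, AddHom.coe_mk, Pi.single_eq_same]
      ext w
      have key : w = Fin.cons a v ↔ w 0 = a ∧ Fin.tail w = v := by
        rw [← Fin.cons_inj (α := fun _ => Fin N), Fin.cons_self_tail]
      rw [consMap_apply]
      by_cases h1 : w 0 = a <;> by_cases h2 : Fin.tail w = v <;>
        simp [h1, h2, Pi.single_apply, key]
    · simp [leftMul, wordSeq, hk]

/-- The product of the generators spelling v acts on the class of the empty word. If the degree n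
component is zero, then every word of length n lies in the ideal. -/
lemma exists_mem_skewComponent {n : ℕ} (v : Fin n → Fin N) :
    ∃ x ∈ skewComponent q R n, skewAction q R x
      (Submodule.Quotient.mk (wordSeq (Fin.elim0 : Fin 0 → Fin N))) =
      Submodule.Quotient.mk (wordSeq v) := by
  induction n with
  | zero =>
    refine ⟨1, ?_, ?_⟩
    · rw [skewComponent, pow_zero]; exact Submodule.one_le.mp le_rfl
    · rw [map_one, Subsingleton.elim v]; rfl
  | succ n ih =>
    obtain ⟨x, hx, hx'⟩ := ih (Fin.tail v)
    refine ⟨RingQuot.mkAlgHom ℂ (SkewRel q R) (FreeAlgebra.ι ℂ (v 0)) * x, ?_, ?_⟩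
    · rw [skewComponent, pow_succ']
      exact Submodule.mul_mem_mul (Submodule.subset_span ⟨_, rfl⟩) hx
    · rw [map_mul, Module.End.mul_apply, hx', skewAction_ι, leftMulQ_mk, leftMul_wordSeq,
        Fin.cons_self_tail]

lemma skewComponent_eq_bot {m n : ℕ} (hm : HasBiRank q R m) (hn : m < n) :
    skewComponent q R n = ⊥ := by
  obtain ⟨H, hH, hs⟩ := hm
  have h0 : Module.finrank ℂ (skewComponent q R n) = 0 := by
    have h1 : PowerSeries.coeff n (skewHilbertSeries q R) =
        Module.finrank ℂ (skewComponent q R n) := by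
      simp [skewHilbertSeries]
    rw [← h1, ← hs, Polynomial.coeff_coe]
    exact Polynomial.coeff_eq_zero_of_natDegree_lt (hH ▸ hn)
  -- A vanishing `finrank` alone would also allow infinite dimension; finite generation excludes it.
  have hfg : (skewComponent q R n).FG :=
    (Submodule.fg_span (Set.finite_range _)).pow n
  have : Module.Finite ℂ (skewComponent q R n) := Module.Finite.iff_fg.mpr hfg
  exact Submodule.finrank_eq_zero.mp h0

/-- If the degree `n + 1` component of the skew-symmetric algebra vanishes, so does every matrix
that is annihilated by all `q⁻¹ + R_i` from the right. -/
lemma eq_zero_of_mul_twoSite {m n : ℕ} (hm : HasBiRank q R m) (hn : m < n + 1)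
    (Z : Matrix (Fin (n + 1) → Fin N) (Fin (n + 1) → Fin N) ℂ)
    (hZ : ∀ i : Fin n, Z * twoSite i (q⁻¹ • 1 + R) = 0) : Z = 0 := by
  have hker : idealComp (q⁻¹ • 1 + R) (n + 1) ≤ LinearMap.ker Z.mulVecLin := by
    refine iSup_le fun i => ?_
    rintro _ ⟨g, rfl⟩
    simp [hZ]
  have hv : ∀ v : Fin (n + 1) → Fin N, Z.mulVec (Pi.single v 1) = 0 := by
    intro v
    obtain ⟨x, hx, hx'⟩ := exists_mem_skewComponent q R v
    rw [skewComponent_eq_bot q R hm hn, Submodule.mem_bot] at hx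
    rw [hx, map_zero, LinearMap.zero_apply, eq_comm, Submodule.Quotient.mk_eq_zero] at hx'
    have := hker (hx' (n + 1) trivial)
    simpa [wordSeq] using this
  ext w v
  simpa using congrFun (hv v) w

end Vanishing

/-! ### The tower attached to a Hecke symmetry -/

section HeckeTower

variable {N : ℕ}

lemma pair_add {ι n A : Type*} [Fintype n] [Ring A] [Algebra ℂ A] (e : ι → n → n → A) (i j : ι)
    (M M' : Matrix (n × n) (n × n) ℂ) : pair e i j (M + M') = pair e i j M + pair e i j M' := by
  simp [pair, add_smul, sum_add_distrib]

lemma pair_smul {ι n A : Type*} [Fintype n] [Ring A] [Algebra ℂ A] (e : ι → n → n → A) (i j : ι)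
    (c : ℂ) (M : Matrix (n × n) (n × n) ℂ) : pair e i j (c • M) = c • pair e i j M := by
  simp [pair, smul_sum, smul_smul]

variable {q : ℂ} {R Ψ : Matrix (Fin N × Fin N) (Fin N × Fin N) ℂ}
  (S : Type*) [Ring S] [Algebra ℂ S]

/-- The action of `R` at the sites `k`, `k + 1`. -/
noncomputable def braidOp (hq0 : q ≠ 0) (hR : IsHeckeSymmetry q R) (k : ℕ) : (Op N S)ˣ where
  val := pair (unitOp S) k (k + 1) R
  inv := pair (unitOp S) k (k + 1) R⁻¹
  val_inv := by
    rw [matrixUnits_unitOp.pair_mul k.succ_ne_self.symm, hR.mul_inv hq0,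
      matrixUnits_unitOp.pair_one]
  inv_val := by
    rw [matrixUnits_unitOp.pair_mul k.succ_ne_self.symm, hR.inv_mul hq0,
      matrixUnits_unitOp.pair_one]

lemma braidOp_mul_self (hq0 : q ≠ 0) (hR : IsHeckeSymmetry q R) (k : ℕ) :
    (braidOp S hq0 hR k : Op N S) * braidOp S hq0 hR k =
      (q - q⁻¹) • (braidOp S hq0 hR k : Op N S) + 1 := by
  simp only [braidOp]
  rw [matrixUnits_unitOp.pair_mul k.succ_ne_self.symm, hR.mul_self hq0, pair_add, pair_smul,
    matrixUnits_unitOp.pair_one]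

/-- The operators that commute with all matrix units at the sites `k, k + 1, …`. -/
def siteFiltration (N : ℕ) (k : ℕ) : Subalgebra ℂ (Op N S) :=
  Subalgebra.centralizer ℂ {x | ∃ j, k ≤ j ∧ ∃ a b, x = unitOp S j a b}

variable {S}

lemma mem_siteFiltration {k : ℕ} {x : Op N S} :
    x ∈ siteFiltration S N k ↔ ∀ j, k ≤ j → ∀ a b, Commute x (unitOp S j a b) := by
  rw [siteFiltration, Subalgebra.mem_centralizer_iff]
  constructor
  · intro h j hj a b
    exact (h _ ⟨j, hj, a, b, rfl⟩).symm
  · rintro h _ ⟨j, hj, a, b, rfl⟩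
    exact (h j hj a b).eq.symm

lemma isTower (hq0 : q ≠ 0) (hR : IsHeckeSymmetry q R) (hΨ : IsSkewInverse R Ψ)
    {L : Matrix (Fin N) (Fin N) S}
    (hL : pair (unitOp S) 0 1 R * firstOp L * pair (unitOp S) 0 1 R * firstOp L =
      firstOp L * pair (unitOp S) 0 1 R * firstOp L * pair (unitOp S) 0 1 R) :
    IsTower (siteFiltration S N) (wtr (unitOp S) (traceMatrix Ψ)) (braidOp S hq0 hR)
      (firstOp L) where
  mono k l hkl x hx := by
    rw [mem_siteFiltration] at hx ⊢
    exact fun j hj => hx j (hkl.trans hj)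
  E_mem {k x} hx := by
    rw [mem_siteFiltration] at hx ⊢
    intro j hj a b
    rcases hj.eq_or_lt with rfl | hj
    · exact (matrixUnits_unitOp.unit_commute_wtr _ _ _ _ _).symm
    · exact (commute_wtr (fun _ _ => matrixUnits_unitOp.comm j k hj.ne' _ _ _ _)
        (hx j hj a b).symm _).symm
  E_left {k y} hy := wtr_mul_left (mem_siteFiltration.mp hy k le_rfl) _
  E_right {k y} hy := wtr_mul_right (mem_siteFiltration.mp hy k le_rfl) _
  r_mem k := by
    rw [mem_siteFiltration]
    intro j hj a b
    exact (commute_pair (fun _ _ => matrixUnits_unitOp.comm _ _ (by omega) _ _ _ _)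
      (fun _ _ => matrixUnits_unitOp.comm _ _ (by omega) _ _ _ _) _).symm
  inv_mem k := by
    rw [mem_siteFiltration]
    intro j hj a b
    exact (commute_pair (fun _ _ => matrixUnits_unitOp.comm _ _ (by omega) _ _ _ _)
      (fun _ _ => matrixUnits_unitOp.comm _ _ (by omega) _ _ _ _) _).symm
  r_comm {k x} hx := by
    rw [mem_siteFiltration] at hx
    exact (commute_pair (hx k le_rfl) (hx (k + 1) (by omega)) _).symm
  E_conj {k x} hx := matrixUnits_unitOp.wtr_conj k.succ_ne_self.symm _ _ _
    (hR.sum_conj hq0 hΨ) (mem_siteFiltration.mp hx (k + 1) le_rfl)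
  E_cyc k x := by
    have he := matrixUnits_unitOp (N := N) (S := S)
    have hk : k ≠ k + 1 := k.succ_ne_self.symm
    -- The two weights are collected into C ⊗ C, which commutes with R; cyclicity of the unweighted
    -- double trace then suffices.
    have h : ∀ y, wtr (unitOp S) (traceMatrix Ψ) k (wtr (unitOp S) (traceMatrix Ψ) (k + 1) y) =
        ptr (unitOp S) k (ptr (unitOp S) (k + 1)
          (pair (unitOp S) k (k + 1) (traceMatrix Ψ ⊗ₖ traceMatrix Ψ) * y)) := by
      intro y
      have : pair (unitOp S) k (k + 1) (traceMatrix Ψ ⊗ₖ traceMatrix Ψ) =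
          site (unitOp S) k (traceMatrix Ψ) * site (unitOp S) (k + 1) (traceMatrix Ψ) := by
        rw [he.site_mul_site]; rfl
      rw [this, mul_assoc, ptr_mul_left]
      · rfl
      · exact fun a b => (commute_site (fun _ _ => he.comm _ _ hk.symm _ _ _ _) _).symm
    rw [h, h]
    simp only [braidOp]
    rw [← mul_assoc, he.pair_mul hk, hR.kronecker_mul_comm hq0 hΨ, ← he.pair_mul hk, mul_assoc,
      he.ptr_ptr_pair hk, mul_assoc]
  braid k := by
    apply Units.ext
    -- The braid relation on three factors is transported to the sites k, k + 1, k + 2.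
    have hf : Function.Injective fun i : Fin 3 => k + (i : ℕ) := fun i j h =>
      Fin.ext (Nat.add_left_cancel h)
    have h := congrArg (fun M => matOp (S := S) _ hf (M.map (algebraMap ℂ S))) hR.braid
    simp only [Matrix.map_mul, map_mul, matOp_twoSite] at h
    exact h
  l_mem := by
    rw [mem_siteFiltration]
    intro j hj a b
    exact Commute.sum_left _ _ _ fun _ _ => Commute.sum_left _ _ _ fun _ _ =>
      (mulOp_commute _ _ _ _).mul_left (matrixUnits_unitOp.comm _ _ (by omega) _ _ _ _)
  refl := hL

/-- The defining relations are pushed to the quotient algebra, then pairs of indices are identified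
with words of length two so that `matOp` applies. -/
lemma reflection_genL (R : Matrix (Fin N × Fin N) (Fin N × Fin N) ℂ) :
    pair (unitOp (REAlgebra R)) 0 1 R * firstOp (genL R) * pair (unitOp (REAlgebra R)) 0 1 R *
      firstOp (genL R) = firstOp (genL R) * pair (unitOp (REAlgebra R)) 0 1 R *
      firstOp (genL R) * pair (unitOp (REAlgebra R)) 0 1 R := by
  have h1 : R.map (algebraMap ℂ (REAlgebra R)) * (genL R ⊗ₖ 1) *
      R.map (algebraMap ℂ (REAlgebra R)) * (genL R ⊗ₖ 1) =
      (genL R ⊗ₖ 1) * R.map (algebraMap ℂ (REAlgebra R)) * (genL R ⊗ₖ 1) *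
      R.map (algebraMap ℂ (REAlgebra R)) := by
    have hR : (R.map (algebraMap ℂ (FreeAlgebra ℂ (Fin N × Fin N)))).map
        (RingQuot.mkAlgHom ℂ (RERel R)) = R.map (algebraMap ℂ (REAlgebra R)) := by
      ext i j
      simp only [Matrix.map_apply, AlgHom.commutes]
    have hL : (freeL N).map (RingQuot.mkAlgHom ℂ (RERel R)) = genL R ⊗ₖ 1 := by
      ext i j
      simp only [freeL, genL, Matrix.map_apply, Matrix.kroneckerMap_apply, Matrix.of_apply,
        map_mul, Matrix.one_apply]
      split_ifs <;> simp
    rw [← hR, ← hL]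
    simp only [← Matrix.map_mul]
    ext i j
    exact RingQuot.mkAlgHom_rel ℂ (RERel.of i j)
  have hf : Function.Injective (Fin.val : Fin 2 → ℕ) := Fin.val_injective
  have e1 : (R.map (algebraMap ℂ (REAlgebra R))).submatrix (finTwoArrowEquiv (Fin N))
      (finTwoArrowEquiv (Fin N)) = (twoSite (0 : Fin 1) R).map (algebraMap ℂ (REAlgebra R)) := by
    ext v w
    simp [twoSite, Fin.forall_fin_two, finTwoArrowEquiv]
  have e2 : (genL R ⊗ₖ 1).submatrix (finTwoArrowEquiv (Fin N))
      (finTwoArrowEquiv (Fin N)) = oneSite (0 : Fin 2) (genL R) := by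
    ext v w
    simp [oneSite, Fin.forall_fin_two, finTwoArrowEquiv, Matrix.one_apply]
  have h2 := congrArg (fun M : Matrix (Fin N × Fin N) (Fin N × Fin N) (REAlgebra R) =>
    matOp Fin.val hf (M.submatrix (finTwoArrowEquiv (Fin N)) (finTwoArrowEquiv (Fin N)))) h1
  simp only [← Matrix.submatrix_mul_equiv _ _ _ (finTwoArrowEquiv (Fin N)) _, e1, e2,
    map_mul] at h2
  rw [matOp_twoSite, matOp_oneSite (n := 1) _ _ rfl] at h2
  exact h2

/-! ### Characteristic elements as brackets -/

/-- The scalar matrices on `V^{⊗n}` acting at the sites `0, …, n - 1`. -/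
noncomputable def scalOp (N : ℕ) (S : Type*) [Ring S] [Algebra ℂ S] (n : ℕ) :
    Matrix (Fin n → Fin N) (Fin n → Fin N) ℂ →ₐ[ℂ] Op N S :=
  (matOp Fin.val Fin.val_injective).comp (Algebra.ofId ℂ S).mapMatrix

lemma scalOp_apply {n : ℕ} (M : Matrix (Fin n → Fin N) (Fin n → Fin N) ℂ) :
    scalOp N S n M = matOp Fin.val Fin.val_injective (M.map (algebraMap ℂ S)) := rfl

lemma scalOp_twoSite {n : ℕ} (i : Fin n) (M : Matrix (Fin N × Fin N) (Fin N × Fin N) ℂ) :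
    scalOp N S (n + 1) (twoSite i M) = pair (unitOp S) i (i + 1) M := by
  rw [scalOp_apply, matOp_twoSite]
  simp

/-- Indicator functions of an initial word read off the entries. Identities proved for operators
thereby descend to matrices. -/
lemma scalOp_injective (hN : 0 < N) (n : ℕ) : Function.Injective (scalOp N ℂ n) := by
  rw [injective_iff_map_eq_zero]
  intro M hM
  ext v w
  have h := congrFun (LinearMap.congr_fun hM fun u => if u ∘ Fin.val = w then 1 else 0)
    (Function.extend Fin.val v fun _ => ⟨0, hN⟩)
  have hext : ∀ (u : Fin n → Fin N) g, Function.extend Fin.val u g ∘ Fin.val = u := fun u g => by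
    funext i; simp [Fin.val_injective.extend_apply]
  rw [scalOp_apply, matOp_apply] at h
  simpa [hext] using h

lemma scalOp_antisymm (hq0 : q ≠ 0) (hR : IsHeckeSymmetry q R) (n : ℕ) (i : Fin (n + 1)) :
    scalOp N S (n + 1) (antisymm q R n i) = asym q (braidOp S hq0 hR) i := by
  induction i using Fin.induction with
  | zero => simp [antisymm, asym]
  | succ i ih =>
    have hdef : antisymm q R n i.succ = (qNum q (i.val + 2))⁻¹ • (antisymm q R n i.castSucc *
        (q ^ (i.val + 1) • (1 : Matrix (Fin (n + 1) → Fin N) (Fin (n + 1) → Fin N) ℂ) -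
        qNum q (i.val + 1) • twoSite i R) * antisymm q R n i.castSucc) := rfl
    rw [hdef, map_smul, map_mul, map_mul, ih, map_sub, map_smul, map_smul, map_one,
      scalOp_twoSite]
    rfl

lemma scalOp_descProd (t : ℕ → (Op N S)ˣ) (M : Matrix (Fin N × Fin N) (Fin N × Fin N) ℂ)
    (ht : ∀ k, (t k : Op N S) = pair (unitOp S) k (k + 1) M) (n : ℕ) :
    scalOp N S (n + 1) (List.ofFn fun i : Fin n => twoSite i M).reverse.prod =
      descProd t 0 n := by
  have h : ∀ m, ((List.ofFn fun i : Fin m => pair (unitOp S) (i : ℕ) (i + 1) M).reverse).prod =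
      (descProd t 0 m : Op N S) := by
    intro m
    induction m with
    | zero => simp [descProd]
    | succ m ih =>
      rw [List.ofFn_succ', List.concat_eq_append, List.reverse_append]
      simp only [List.reverse_cons, List.reverse_nil, List.nil_append, List.singleton_append,
        List.prod_cons, descProd, Units.val_mul, zero_add, ht, Fin.val_castSucc, Fin.val_last, ih]
  rw [map_list_prod, List.map_reverse, List.map_ofFn, ← h]
  simp only [Function.comp_def, scalOp_twoSite]

lemma matOp_barL (hq0 : q ≠ 0) (hR : IsHeckeSymmetry q R) (n : ℕ) (i : Fin (n + 1)) :
    matOp Fin.val Fin.val_injective (barL R n i) =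
      copyL (braidOp (REAlgebra R) hq0 hR) (firstOp (genL R)) i := by
  induction i using Fin.induction with
  | zero => exact matOp_oneSite _ _ rfl _
  | succ i ih =>
    have hdef : barL R n i.succ =
      scal R (twoSite i R) * barL R n i.castSucc * scal R (twoSite i R⁻¹) := rfl
    rw [hdef, map_mul, map_mul, ih, scal, scal, ← scalOp_apply, ← scalOp_apply, scalOp_twoSite,
      scalOp_twoSite]
    rfl

lemma matOp_barLProd (hq0 : q ≠ 0) (hR : IsHeckeSymmetry q R) (n : ℕ) :
    matOp Fin.val Fin.val_injective (barLProd R n) =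
      prodL (braidOp (REAlgebra R) hq0 hR) (firstOp (genL R)) 0 (n + 1) := by
  have h : ∀ m, (List.ofFn fun i : Fin m =>
      copyL (braidOp (REAlgebra R) hq0 hR) (firstOp (genL R)) i).prod =
      prodL (braidOp (REAlgebra R) hq0 hR) (firstOp (genL R)) 0 m := by
    intro m
    induction m with
    | zero => simp [prodL]
    | succ m ih =>
      rw [List.ofFn_succ', List.concat_eq_append, List.prod_append]
      simp only [List.prod_singleton, prodL, zero_add, Fin.val_castSucc, Fin.val_last, ih]
  rw [barLProd, map_list_prod, List.map_ofFn, ← h]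
  simp only [Function.comp_def, matOp_barL hq0 hR]

/-- The bridge from the concrete characteristic elements to the brackets of the abstract tower. -/
lemma mulOp_charElt (hq0 : q ≠ 0) (hR : IsHeckeSymmetry q R) {n : ℕ}
    (Z : Matrix (Fin (n + 1) → Fin N) (Fin (n + 1) → Fin N) ℂ) :
    mulOp N (REAlgebra R) (charElt R Ψ Z) =
      brk (wtr (unitOp (REAlgebra R)) (traceMatrix Ψ)) (braidOp (REAlgebra R) hq0 hR)
        (firstOp (genL R)) (n + 1) (scalOp N (REAlgebra R) (n + 1) Z) := by
  rw [charElt, scal, ← iterE_matOp, brk, map_mul, matOp_barLProd hq0 hR]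
  rfl

/-! ### Newton identities and vanishing -/

lemma charElt_eq_zero_of_isEmpty (hN : N = 0) {n : ℕ}
    (Z : Matrix (Fin (n + 1) → Fin N) (Fin (n + 1) → Fin N) ℂ) : charElt R Ψ Z = 0 := by
  subst hN
  have : IsEmpty (Fin (n + 1) → Fin 0) := ⟨fun f => (f 0).elim0⟩
  simp [charElt, Matrix.trace]

variable (hq0 : q ≠ 0) (hq : ∀ k : ℕ, 1 ≤ k → q ^ k ≠ 1) (hR : IsHeckeSymmetry q R)
  (hΨ : IsSkewInverse R Ψ)
include hq0 hq hR hΨ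

theorem newton_powerSum (k : ℕ) :
    qNum q (k + 1) • elemSymm q R Ψ (k + 1) = ∑ i ∈ range (k + 1),
      ((-1) ^ (k - i) * q ^ i) • (elemSymm q R Ψ i * powerSum R Ψ (k + 1 - i)) := by
  rcases N.eq_zero_or_pos with hN | hN
  · have h : ∀ n, powerSum R Ψ n = 0 := by
      rintro (_ | n)
      · rfl
      · exact charElt_eq_zero_of_isEmpty hN _
    simp [h, elemSymm, charElt_eq_zero_of_isEmpty hN]
  have hT := isTower hq0 hR hΨ (reflection_genL R)
  apply mulOp_injective hN
  simp only [map_sum, map_smul, map_mul]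
  -- Y(i,n) is the bracket of A^(i+1) R_{i+n} ⋯ R_{i+1} on i + n + 1 factors; it interpolates
  -- between a_{i+1} at n = 0 and p_{n+1} at i = 0.
  refine sum_of_newton_step (B := Op N (REAlgebra R)) (qNum q) (q ^ ·) (fun i n => brk
    (wtr (unitOp (REAlgebra R)) (traceMatrix Ψ)) (braidOp (REAlgebra R) hq0 hR)
        (firstOp (genL R)) (i + n + 1) (asym (A := Op N (REAlgebra R)) q (braidOp (REAlgebra R) hq0 hR) i *
        descProd (A := Op N (REAlgebra R)) (fun k => braidOp (REAlgebra R) hq0 hR k ^ (1 : ℤ)) i n))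
    (fun i => mulOp N _ (elemSymm q R Ψ i)) (fun i => mulOp N _ (powerSum R Ψ i))
    (qNum_one (sub_inv_ne_zero hq0 hq)) (pow_zero q) (by exact map_one _) (fun i => ?_) (fun n => ?_)
    (fun i n => ?_) k
  · rw [elemSymm, mulOp_charElt hq0 hR, scalOp_antisymm hq0 hR]
    simp [descProd]
  · rw [powerSum, mulOp_charElt hq0 hR, scalOp_descProd
      (fun k => braidOp (REAlgebra R) hq0 hR k ^ (1 : ℤ)) R fun k => by rw [zpow_one]; rfl]
    simp [asym]
  · have := hT.newton_step_one hq0 hq (braidOp_mul_self _ hq0 hR) i n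
    simpa [descProd, asym] using this

theorem newton_powerSum' (k : ℕ) :
    qNum q (k + 1) • elemSymm q R Ψ (k + 1) = ∑ i ∈ range (k + 1),
      ((-1) ^ (k - i) * q⁻¹ ^ i) • (elemSymm q R Ψ i * powerSum' R Ψ (k + 1 - i)) := by
  rcases N.eq_zero_or_pos with hN | hN
  · have h : ∀ n, powerSum' R Ψ n = 0 := by
      rintro (_ | n)
      · rfl
      · exact charElt_eq_zero_of_isEmpty hN _
    simp [h, elemSymm, charElt_eq_zero_of_isEmpty hN]
  have hT := isTower hq0 hR hΨ (reflection_genL R)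
  apply mulOp_injective hN
  simp only [map_sum, map_smul, map_mul]
  refine sum_of_newton_step (B := Op N (REAlgebra R)) (qNum q) (q⁻¹ ^ ·) (fun i n => brk
    (wtr (unitOp (REAlgebra R)) (traceMatrix Ψ)) (braidOp (REAlgebra R) hq0 hR)
        (firstOp (genL R)) (i + n + 1) (asym (A := Op N (REAlgebra R)) q (braidOp (REAlgebra R) hq0 hR) i *
        descProd (A := Op N (REAlgebra R)) (fun k => braidOp (REAlgebra R) hq0 hR k ^ (-1 : ℤ)) i n))
    (fun i => mulOp N _ (elemSymm q R Ψ i)) (fun i => mulOp N _ (powerSum' R Ψ i))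
    (qNum_one (sub_inv_ne_zero hq0 hq)) (pow_zero _) (by exact map_one _) (fun i => ?_) (fun n => ?_)
    (fun i n => ?_) k
  · rw [elemSymm, mulOp_charElt hq0 hR, scalOp_antisymm hq0 hR]
    simp [descProd]
  · rw [powerSum', mulOp_charElt hq0 hR, scalOp_descProd
      (fun k => braidOp (REAlgebra R) hq0 hR k ^ (-1 : ℤ)) R⁻¹ fun k => by
        rw [zpow_neg_one]; rfl]
    simp [asym]
  · have := hT.newton_step_neg_one hq0 hq (braidOp_mul_self _ hq0 hR) i n
    simpa [descProd, asym] using this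

theorem elemSymm_eq_zero {m k : ℕ} (hm : HasBiRank q R m) (hk : m < k) :
    elemSymm q R Ψ k = 0 := by
  obtain ⟨n, rfl⟩ : ∃ n, k = n + 1 := ⟨k - 1, by omega⟩
  rcases N.eq_zero_or_pos with hN | hN
  · exact charElt_eq_zero_of_isEmpty hN _
  have h0 : antisymm q R n (Fin.last n) = 0 := by
    refine eq_zero_of_mul_twoSite q R hm hk _ fun i => ?_
    apply scalOp_injective hN
    -- The antisymmetrizer does not involve L, so scalar coefficients and L = 0, for which the
    -- reflection equation is trivial, are enough.
    have hT := isTower (S := ℂ) hq0 hR hΨ (L := 0) (by simp [firstOp])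
    have h := (hT.asym_spec hq0 hq (braidOp_mul_self ℂ hq0 hR) n).2 i i.isLt
    have hb : (braidOp ℂ hq0 hR i : Op N ℂ) = pair (unitOp ℂ) i (i + 1) R := rfl
    rw [map_mul, scalOp_antisymm hq0 hR, scalOp_twoSite, pair_add, pair_smul,
      matrixUnits_unitOp.pair_one, ← hb, Fin.val_last, mul_add, h, map_zero]
    simp
  rw [elemSymm, h0]
  simp [charElt, scal]

end HeckeTower

/-! ### Generating functions -/

section Generating

lemma coeff_prod_lin {K : Type*} [CommRing K] {m : ℕ} (ν : Fin m → K) (k : ℕ) :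
    PowerSeries.coeff k (∏ i, lin (ν i)) =
      (-1) ^ k * ∑ s ∈ powersetCard k (univ : Finset (Fin m)), ∏ i ∈ s, ν i := by
  have h : ∀ i, lin (ν i) = 1 + PowerSeries.C (-ν i) * PowerSeries.X := fun i => by
    simp [lin, sub_eq_add_neg]
  have hc : ∀ s : Finset (Fin m), PowerSeries.coeff k
      (∏ i ∈ s, (PowerSeries.C (-ν i) * PowerSeries.X)) =
      if #s = k then (-1) ^ k * ∏ i ∈ s, ν i else 0 := by
    intro s
    rw [prod_mul_distrib, ← map_prod, prod_const, prod_neg, PowerSeries.coeff_C_mul,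
      PowerSeries.coeff_X_pow]
    split_ifs with h1 h2 h2
    · simp [h1]
    · exact absurd h1.symm h2
    · exact absurd h2.symm h1
    · simp
  simp only [h, prod_one_add, map_sum, hc]
  rw [← sum_filter, ← mul_sum, ← powersetCard_eq_filter]

lemma coeff_prod_smul_lin {K : Type*} [CommRing K] [Algebra ℂ K] {m : ℕ} (ν : Fin m → K) (u : ℂ)
    (k : ℕ) : PowerSeries.coeff k (∏ i, lin (u • ν i)) =
      ((-1) ^ k * u ^ k) • ∑ s ∈ powersetCard k (univ : Finset (Fin m)), ∏ i ∈ s, ν i := by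
  have h : ∑ s ∈ powersetCard k (univ : Finset (Fin m)), ∏ i ∈ s, u • ν i =
      u ^ k • ∑ s ∈ powersetCard k (univ : Finset (Fin m)), ∏ i ∈ s, ν i := by
    rw [smul_sum]
    refine sum_congr rfl fun s hs => ?_
    rw [prod_smul, prod_const, (mem_powersetCard.mp hs).2]
  have h1 : (-1 : K) ^ k = algebraMap ℂ K ((-1) ^ k) := by simp
  rw [coeff_prod_lin, h, h1, ← Algebra.smul_def, smul_smul]

variable {E : Type*} [Ring E] [Algebra ℂ E] {m : ℕ}

lemma coeff_prod_lin_smul (μ : Fin m → Subalgebra.center ℂ E) (u : ℂ) (k : ℕ) :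
    PowerSeries.coeff k (PowerSeries.map (Subalgebra.center ℂ E).val.toRingHom
      (∏ i, lin (u • μ i))) =
      ((-1) ^ k * u ^ k) • ((∑ s ∈ powersetCard k univ, ∏ i ∈ s, μ i :
        Subalgebra.center ℂ E) : E) := by
  rw [PowerSeries.coeff_map, coeff_prod_smul_lin]
  rfl

/-- A Newton recursion for the coefficients of `∏ (1 - μ_i x)` as an identity of power series. -/
lemma prod_lin_mul_mk {q : ℂ} (hq0 : q ≠ 0) (hω : q - q⁻¹ ≠ 0)
    (μ : Fin m → Subalgebra.center ℂ E) (a p : ℕ → E) (hp : p 0 = 0)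
    (ha : ∀ k, q ^ k • a k = ((∑ s ∈ powersetCard k univ, ∏ i ∈ s, μ i :
        Subalgebra.center ℂ E) : E)) (u : ℂ)
    (hN : ∀ k, qNum q (k + 1) • a (k + 1) = ∑ i ∈ range (k + 1),
      ((-1) ^ (k - i) * (u * q) ^ i) • (a i * p (k + 1 - i))) :
    PowerSeries.map (Subalgebra.center ℂ E).val.toRingHom (∏ i, lin (u • μ i)) *
      ((q - q⁻¹) • PowerSeries.mk p) =
    PowerSeries.map (Subalgebra.center ℂ E).val.toRingHom (∏ i, lin ((q ^ 2)⁻¹ • μ i)) -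
      PowerSeries.map (Subalgebra.center ℂ E).val.toRingHom (∏ i, lin (μ i)) := by
  have h1 : ∏ i, lin (μ i) = ∏ i, lin ((1 : ℂ) • μ i) := by simp
  rw [h1]
  ext k
  rw [map_sub, coeff_prod_lin_smul, coeff_prod_lin_smul, PowerSeries.coeff_mul,
    Nat.sum_antidiagonal_eq_sum_range_succ_mk]
  simp only [coeff_prod_lin_smul, ← ha, PowerSeries.coeff_smul, PowerSeries.coeff_mk]
  rcases k with _ | k
  · simp [hp]
  -- Because p_0 = 0, the top term of the convolution drops out and the range is that of the Newton
  -- identity.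
  rw [sum_range_succ, Nat.sub_self, hp, smul_zero, mul_zero, add_zero]
  have h2 : ∀ i ∈ range (k + 1), ((-1) ^ i * u ^ i) • q ^ i • a i * (q - q⁻¹) • p (k + 1 - i) =
      ((-1) ^ k * (q - q⁻¹)) •
        (((-1) ^ (k - i) * (u * q) ^ i) • (a i * p (k + 1 - i))) := by
    intro i hi
    have hi' : i ≤ k := Nat.lt_succ_iff.mp (mem_range.mp hi)
    have hs : (-1 : ℂ) ^ k * (-1) ^ (k - i) = (-1) ^ i := by
      obtain ⟨d, rfl⟩ := Nat.exists_eq_add_of_le hi'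
      rw [Nat.add_sub_cancel_left, pow_add, mul_assoc, ← mul_pow]
      simp
    rw [smul_smul, smul_mul_smul_comm, smul_smul, ← hs, mul_pow]
    congr 1
    ring
  -- By ω (k+1)_q = q^{k+1} - q^{-(k+1)} the left side splits into the two elementary symmetric
  -- terms, since q^{-(k+1)} a_{k+1} is q^{-2(k+1)} times q^{k+1} a_{k+1}.
  rw [sum_congr rfl h2, ← smul_sum, ← hN, smul_smul, smul_smul, smul_smul, ← sub_smul,
    mul_assoc ((-1 : ℂ) ^ k), mul_qNum hω]
  congr 1
  have : (q ^ 2)⁻¹ ^ (k + 1) * q ^ (k + 1) = q⁻¹ ^ (k + 1) := by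
    rw [← mul_pow]; congr 1; field_simp
  rw [mul_assoc _ ((q ^ 2)⁻¹ ^ (k + 1)), this]
  ring

lemma prod_linInv_mul {K : Type*} [CommRing K] (ν : Fin m → K) :
    (∏ i, linInv (ν i)) * ∏ i, lin (ν i) = 1 := by
  rw [← prod_mul_distrib]
  exact prod_eq_one fun i _ => by rw [mul_comm, lin_mul_linInv]

/-- Division by `∏ (1 - ν_i x)`. -/
lemma eq_map_prod_of_mul_eq (ν ρ : Fin m → Subalgebra.center ℂ E) (f : PowerSeries E)
    (h : PowerSeries.map (Subalgebra.center ℂ E).val.toRingHom (∏ i, lin (ν i)) * f =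
      PowerSeries.map (Subalgebra.center ℂ E).val.toRingHom (∏ i, lin (ρ i))) :
    f = PowerSeries.map (Subalgebra.center ℂ E).val.toRingHom
      (∏ i, lin (ρ i) * linInv (ν i)) := by
  -- Commutativity is used only over the centre; f may have noncentral coefficients, so the inverse
  -- multiplies it from the left.
  rw [prod_mul_distrib, mul_comm, map_mul, ← h, ← mul_assoc, ← map_mul, prod_linInv_mul, map_one,
    one_mul]

end Generating

end ReflectionEq

/-! ### The parametrization of both generating functions. -/

theorem mainTheorem4 {N m : ℕ} (q : ℂ) (hq0 : q ≠ 0) (hq : ∀ k : ℕ, 1 ≤ k → q ^ k ≠ 1)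
    (R Ψ : Matrix (Fin N × Fin N) (Fin N × Fin N) ℂ)
    (hR : ReflectionEq.IsHeckeSymmetry q R)
    (hΨ : ReflectionEq.IsSkewInverse R Ψ)
    (hm : ReflectionEq.HasBiRank q R m)
    {E : Type*} [Ring E] [Algebra ℂ E] (φ : ReflectionEq.REAlgebra R →ₐ[ℂ] E)
    (μ : Fin m → Subalgebra.center ℂ E)
    (hμ : ReflectionEq.IsSpectrum q R Ψ φ μ) :
    1 + (q - q⁻¹) • PowerSeries.map (φ : ReflectionEq.REAlgebra R →+* E)
          (ReflectionEq.genP R Ψ) =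
        PowerSeries.map (Subalgebra.center ℂ E).val.toRingHom
          (∏ i, ReflectionEq.lin ((q ^ 2)⁻¹ • μ i) * ReflectionEq.linInv (μ i)) ∧
      1 - (q - q⁻¹) • PowerSeries.map (φ : ReflectionEq.REAlgebra R →+* E)
          (ReflectionEq.genT R Ψ) =
        PowerSeries.map (Subalgebra.center ℂ E).val.toRingHom
          (∏ i, ReflectionEq.lin (μ i) * ReflectionEq.linInv ((q ^ 2)⁻¹ • μ i)) := by
  have hω := ReflectionEq.sub_inv_ne_zero hq0 hq
  -- The spectral relations extend to every k: both sides are 1 for k = 0 and 0 for k > m, where the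
  -- bi-rank enters.
  have ha : ∀ k, q ^ k • φ (ReflectionEq.elemSymm q R Ψ k) =
      ((∑ s ∈ Finset.powersetCard k Finset.univ, ∏ i ∈ s, μ i : Subalgebra.center ℂ E) : E) := by
    intro k
    rcases k.eq_zero_or_pos with rfl | hk
    · simp [ReflectionEq.elemSymm]
    rcases le_or_gt k m with hkm | hkm
    · rw [← map_smul]
      exact hμ k hk hkm
    · rw [ReflectionEq.elemSymm_eq_zero hq0 hq hR hΨ hm hkm,
        Finset.powersetCard_eq_empty.mpr (by simpa using hkm)]
      simp
  have hP : PowerSeries.map (φ : ReflectionEq.REAlgebra R →+* E) (ReflectionEq.genP R Ψ) =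
      PowerSeries.mk fun k => φ (ReflectionEq.powerSum R Ψ k) := by
    ext k; simp [ReflectionEq.genP]
  have hT : PowerSeries.map (φ : ReflectionEq.REAlgebra R →+* E) (ReflectionEq.genT R Ψ) =
      PowerSeries.mk fun k => φ (ReflectionEq.powerSum' R Ψ k) := by
    ext k; simp [ReflectionEq.genT]
  rw [hP, hT]
  constructor
  · apply ReflectionEq.eq_map_prod_of_mul_eq
    have h := ReflectionEq.prod_lin_mul_mk hq0 hω μ _ (fun k => φ (ReflectionEq.powerSum R Ψ k))
      (map_zero φ) ha 1 fun k => by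
        have := congrArg φ (ReflectionEq.newton_powerSum hq0 hq hR hΨ k)
        simpa only [map_sum, map_smul, map_mul, one_mul] using this
    simp only [one_smul] at h
    rw [mul_add, mul_one, h, add_sub_cancel]
  · apply ReflectionEq.eq_map_prod_of_mul_eq
    -- The choice u = q⁻² makes u q = q⁻¹, the base of the powers in the second Newton identity.
    have h := ReflectionEq.prod_lin_mul_mk hq0 hω μ _ (fun k => φ (ReflectionEq.powerSum' R Ψ k))
      (map_zero φ) ha (q ^ 2)⁻¹ fun k => by
        have hq2 : (q ^ 2)⁻¹ * q = q⁻¹ := by field_simp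
        have := congrArg φ (ReflectionEq.newton_powerSum' hq0 hq hR hΨ k)
        simpa only [map_sum, map_smul, map_mul, hq2] using this
    rw [mul_sub, mul_one, h, sub_sub_cancel]
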